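/- Let $k$ be a field of characteristic $0$ and write $\otimes=\otimes_k$. A double bracket on a unital associative $k$-algebra $A$ is a $k$-bilinear map $\{\!\{-,-\}\!\}:A\times A\to A\otimes A$ with $\{\!\{a,b\}\!\}=-\{\!\{b,a\}\!\}^{\circ}$, where $^\circ$ swaps the two tensor factors, and $\{\!\{a,bc\}\!\}=\{\!\{a,b\}\!\}\,c+b\,\{\!\{a,c\}\!\}$, where $b\,(d'\otimes d'')\,c=bd'\otimes d''c$. It is Poisson if for all $a,b,c\in A$ $$\{\!\{a,\{\!\{b,c\}\!\}'\}\!\}\otimes\{\!\{b,c\}\!\}''+\tau\big(\{\!\{b,\{\!\{c,a\}\!\}'\}\!\}\otimes\{\!\{c,a\}\!\}''\big)+\tau^2\big(\{\!\{c,\{\!\{a,b\}\!\}'\}\!\}\otimes\{\!\{a,b\}\!\}''\big)=0,$$ where $d=d'\otimes d''$ is Sweedler notation for $d\in A\otimes A$ and $\tau(a_1\otimes a_2\otimes a_3)=a_3\otimes a_1\otimes a_2$. An element $\mu\in A$ is a moment map if $\{\!\{\mu,a\}\!\}=a\otimes 1-1\otimes a$ for all $a\in A$. If the double bracket is Poisson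 and $\mu$ is a moment map, then $(A,\{\!\{-,-\}\!\},\mu)$ is called a Hamiltonian algebra, and $\operatorname{HAut}(A)$ denotes the group of $k$-algebra automorphisms $\phi$ of $A$ such that $\{\!\{\phi(a),\phi(b)\}\!\}=(\phi\otimes\phi)\{\!\{a,b\}\!\}$ for all $a,b\in A$, and $\phi(\mu)=\mu$. Let $F_2=k\langle x,y\rangle$ be the free algebra on two generators, with the unique double bracket such that $\{\!\{x,y\}\!\}=1\otimes 1$ and $\{\!\{x,x\}\!\}=0=\{\!\{y,y\}\!\}$, and let $\mu=[x,y]=xy-yx$. Let $A_1=k\langle x,y\rangle/(xy-yx-1)$ be the first Weyl algebra. Then this double bracket is Poisson and $\mu$ is a moment map, so that $F_2$ is a Hamiltonian algebra. Moreover, every $\phi\in\operatorname{HAut}(F_2)$ descends to an automorphism $\bar\phi$ of the $k$-algebra $A_1$, and the resulting group homomorphism $$\operatorname{HAut}(F_2)\to\operatorname{Aut}_k(A_1),\qquad \phi\mapsto\bar\phi,$$ is surjective. -/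

import Mathlib

open scoped TensorProduct

universe u v w

/-- A double bracket on a `k`-algebra `A`: a `k`-bilinear map `A × A → A ⊗ A` which is cyclically
antisymmetric and satisfies the right derivation rule. For `d : A ⊗ A`, the outer bimodule action
`b d c = (b d') ⊗ (d'' c)` is written as the product `(b ⊗ 1) * d * (1 ⊗ c)` in the algebra
`A ⊗ A`. -/
structure DoubleBracket (k : Type u) (A : Type v) [Field k] [Ring A] [Algebra k A] where
  /-- the underlying bilinear map -/
  bracket : A →ₗ[k] A →ₗ[k] A ⊗[k] A
  cyclic_antisymm : ∀ a b : A, bracket a b = -TensorProduct.comm k A A (bracket b a)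
  right_derivation : ∀ a b c : A,
    bracket a (b * c) = bracket a b * (1 ⊗ₜ[k] c) + (b ⊗ₜ[k] 1) * bracket a c

namespace DoubleBracket

section general

variable {k : Type u} {A : Type v} [Field k] [Ring A] [Algebra k A]

/-- The cyclic permutation `a₁ ⊗ a₂ ⊗ a₃ ↦ a₃ ⊗ a₁ ⊗ a₂` of `A ⊗ A ⊗ A`. -/
noncomputable def cyclicPerm (k : Type u) (A : Type v) [Field k] [Ring A] [Algebra k A] :
    (A ⊗[k] A) ⊗[k] A →ₗ[k] (A ⊗[k] A) ⊗[k] A :=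
  (TensorProduct.assoc k A A A).symm.toLinearMap ∘ₗ
    (TensorProduct.comm k (A ⊗[k] A) A).toLinearMap

theorem cyclicPerm_tmul (a b c : A) :
    cyclicPerm k A ((a ⊗ₜ[k] b) ⊗ₜ[k] c) = (c ⊗ₜ[k] a) ⊗ₜ[k] b := by
  simp [cyclicPerm]

/-- The extension `d ↦ {{a, d'}} ⊗ d''` of `{{a, -}}` to `A ⊗ A`. -/
noncomputable def leftExtend (D : DoubleBracket k A) (a : A) :
    A ⊗[k] A →ₗ[k] (A ⊗[k] A) ⊗[k] A :=
  LinearMap.rTensor A (D.bracket a)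

/-- The triple bracket associated with a double bracket. -/
noncomputable def tripleBracket (D : DoubleBracket k A) (a b c : A) : (A ⊗[k] A) ⊗[k] A :=
  D.leftExtend a (D.bracket b c)
    + cyclicPerm k A (D.leftExtend b (D.bracket c a))
    + cyclicPerm k A (cyclicPerm k A (D.leftExtend c (D.bracket a b)))

/-- A double bracket is Poisson if the associated triple bracket vanishes identically. -/
def IsPoisson (D : DoubleBracket k A) : Prop :=
  ∀ a b c : A, D.tripleBracket a b c = 0

/-- Moment maps, in the case where the base ring is `k` itself (so that `1` is the only
idempotent of the base): `{{μ, a}} = a ⊗ 1 - 1 ⊗ a` for all `a`. -/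
def IsMomentMap (D : DoubleBracket k A) (μ : A) : Prop :=
  ∀ a : A, D.bracket μ a = a ⊗ₜ[k] 1 - 1 ⊗ₜ[k] a

/-- An algebra homomorphism is a morphism of double brackets if it intertwines the brackets. -/
def IsMorphism {A' : Type w} [Ring A'] [Algebra k A'] (D : DoubleBracket k A)
    (D' : DoubleBracket k A') (φ : A →ₐ[k] A') : Prop :=
  ∀ a b : A, D'.bracket (φ a) (φ b) = Algebra.TensorProduct.map φ φ (D.bracket a b)

/-- The group `HAut(A)` of automorphisms of a Hamiltonian algebra `(A, D, μ)`: algebra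
automorphisms which are morphisms of double brackets and fix the moment map. -/
def hamiltonianAut (D : DoubleBracket k A) (μ : A) : Subgroup (A ≃ₐ[k] A) where
  carrier := {φ | D.IsMorphism D (φ : A →ₐ[k] A) ∧ φ μ = μ}
  one_mem' := by
    refine ⟨fun a b => ?_, rfl⟩
    have h : ((1 : A ≃ₐ[k] A) : A →ₐ[k] A) = AlgHom.id k A := rfl
    rw [h, Algebra.TensorProduct.map_id]
    rfl
  mul_mem' := by
    rintro φ ψ ⟨hφ, hφμ⟩ ⟨hψ, hψμ⟩
    refine ⟨fun a b => ?_, by rw [AlgEquiv.mul_apply, hψμ, hφμ]⟩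
    have h : ((φ * ψ : A ≃ₐ[k] A) : A →ₐ[k] A) = (φ : A →ₐ[k] A).comp (ψ : A →ₐ[k] A) := rfl
    rw [h, Algebra.TensorProduct.map_comp, AlgHom.comp_apply, AlgHom.comp_apply,
      AlgHom.comp_apply, hφ, hψ]
  inv_mem' := by
    rintro φ ⟨hφ, hφμ⟩
    refine ⟨fun a b => ?_, ?_⟩
    · have h1 : (φ : A →ₐ[k] A) ((φ⁻¹ : A ≃ₐ[k] A) a) = a := φ.apply_symm_apply a
      have h2 : (φ : A →ₐ[k] A) ((φ⁻¹ : A ≃ₐ[k] A) b) = b := φ.apply_symm_apply b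
      have h := hφ ((φ⁻¹ : A ≃ₐ[k] A) a) ((φ⁻¹ : A ≃ₐ[k] A) b)
      rw [h1, h2] at h
      have hid : ((φ⁻¹ : A ≃ₐ[k] A) : A →ₐ[k] A).comp (φ : A →ₐ[k] A) = AlgHom.id k A := by
        ext c
        exact φ.symm_apply_apply c
      rw [h, ← AlgHom.comp_apply, ← Algebra.TensorProduct.map_comp, hid,
        Algebra.TensorProduct.map_id]
      rfl
    · calc (φ⁻¹ : A ≃ₐ[k] A) μ = (φ⁻¹ : A ≃ₐ[k] A) (φ μ) := by rw [hφμ]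
        _ = μ := φ.symm_apply_apply μ

/-- The bilinear map `(p ⊗ q, r ⊗ s) ↦ (r q) ⊗ (p s)`. -/
noncomputable def interchange (k : Type u) (A : Type v) [Field k] [Ring A] [Algebra k A] :
    A ⊗[k] A →ₗ[k] A ⊗[k] A →ₗ[k] A ⊗[k] A :=
  TensorProduct.lift <| LinearMap.mk₂ k
    (fun p q => TensorProduct.map (LinearMap.mulRight k q) (LinearMap.mulLeft k p))
    (by intros; ext; simp [TensorProduct.tmul_add, add_mul])
    (by intros; ext; simp)
    (by intros; ext; simp [TensorProduct.add_tmul, mul_add])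
    (by intros; ext; simp [TensorProduct.smul_tmul'])

theorem interchange_tmul (p q r s : A) :
    interchange k A (p ⊗ₜ[k] q) (r ⊗ₜ[k] s) = (r * q) ⊗ₜ[k] (p * s) := by
  simp [interchange]

theorem interchange_comm (d e : A ⊗[k] A) :
    interchange k A d e = TensorProduct.comm k A A (interchange k A e d) := by
  induction d using TensorProduct.induction_on with
  | zero => simp
  | add d₁ d₂ h₁ h₂ => simp [h₁, h₂]
  | tmul p q =>
    induction e using TensorProduct.induction_on with
    | zero => simp
    | add e₁ e₂ h₁ h₂ => simp [h₁, h₂]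
    | tmul r s => simp [interchange_tmul]

theorem interchange_mul (d e : A ⊗[k] A) (b c : A) :
    interchange k A d ((b ⊗ₜ[k] 1) * e * (1 ⊗ₜ[k] c)) =
      (b ⊗ₜ[k] 1) * interchange k A d e * (1 ⊗ₜ[k] c) := by
  induction d using TensorProduct.induction_on with
  | zero => simp
  | add d₁ d₂ h₁ h₂ => simp [h₁, h₂, mul_add, add_mul]
  | tmul p q =>
    induction e using TensorProduct.induction_on with
    | zero => simp
    | add e₁ e₂ h₁ h₂ => simp [h₁, h₂, mul_add, add_mul]
    | tmul r s => simp [interchange_tmul, mul_assoc]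

/-- The double bracket `{{a, b}} = (∂₂ b)' (∂₁ a)'' ⊗ (∂₁ a)' (∂₂ b)'' - (∂₁ b)' (∂₂ a)'' ⊗ (∂₂ a)' (∂₁ b)''`
associated with two double derivations `∂₁, ∂₂` of `A`. -/
noncomputable def ofDoubleDerivations (d₁ d₂ : A →ₗ[k] A ⊗[k] A)
    (h₁ : ∀ b c, d₁ (b * c) = d₁ b * (1 ⊗ₜ[k] c) + (b ⊗ₜ[k] 1) * d₁ c)
    (h₂ : ∀ b c, d₂ (b * c) = d₂ b * (1 ⊗ₜ[k] c) + (b ⊗ₜ[k] 1) * d₂ c) : DoubleBracket k A where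
  bracket := (interchange k A).compl₁₂ d₁ d₂ - (interchange k A).compl₁₂ d₂ d₁
  cyclic_antisymm a b := by
    simp only [LinearMap.sub_apply, LinearMap.compl₁₂_apply, map_sub, ← interchange_comm]
    abel
  right_derivation a b c := by
    have one_left : ∀ d e : A ⊗[k] A, ∀ c : A,
        interchange k A d (e * (1 ⊗ₜ[k] c)) = interchange k A d e * (1 ⊗ₜ[k] c) := by
      intro d e c
      simpa [← Algebra.TensorProduct.one_def] using interchange_mul d e 1 c
    have one_right : ∀ d e : A ⊗[k] A, ∀ b : A,
        interchange k A d ((b ⊗ₜ[k] 1) * e) = (b ⊗ₜ[k] 1) * interchange k A d e := by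
      intro d e b
      simpa [← Algebra.TensorProduct.one_def] using interchange_mul d e b 1
    simp only [LinearMap.sub_apply, LinearMap.compl₁₂_apply, h₁, h₂, map_add, one_left, one_right,
      sub_mul, mul_sub]
    abel

theorem ofDoubleDerivations_apply (d₁ d₂ : A →ₗ[k] A ⊗[k] A) (h₁ h₂) (a b : A) :
    (ofDoubleDerivations d₁ d₂ h₁ h₂).bracket a b =
      interchange k A (d₁ a) (d₂ b) - interchange k A (d₂ a) (d₁ b) := rfl

end general

end DoubleBracket

/-- The free algebra `F₂ = k⟨x, y⟩`. -/
abbrev F2 (k : Type u) [Field k] : Type u := FreeAlgebra k (Fin 2)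

namespace F2

section construction

variable (k : Type u) [Field k]

/-- The first generator. -/
noncomputable def x : F2 k := FreeAlgebra.ι k 0

/-- The second generator. -/
noncomputable def y : F2 k := FreeAlgebra.ι k 1

/-- The algebra homomorphism `a ↦ (a ⊗ 1, ∂ᵢ a; 0, 1 ⊗ a)` to upper triangular matrices over
`F₂ ⊗ F₂`, which encodes the double derivation `∂ᵢ` with `∂ᵢ (ι j) = δᵢⱼ 1 ⊗ 1`. -/
noncomputable def triangular (i : Fin 2) : F2 k →ₐ[k] Matrix (Fin 2) (Fin 2) (F2 k ⊗[k] F2 k) :=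
  FreeAlgebra.lift k fun j =>
    !![FreeAlgebra.ι k j ⊗ₜ[k] 1, if j = i then 1 ⊗ₜ[k] 1 else 0; 0, 1 ⊗ₜ[k] FreeAlgebra.ι k j]

theorem triangular_diag (i : Fin 2) (a : F2 k) :
    triangular k i a 0 0 = a ⊗ₜ[k] 1 ∧ triangular k i a 1 0 = 0 ∧
      triangular k i a 1 1 = 1 ⊗ₜ[k] a := by
  induction a using FreeAlgebra.induction with
  | grade0 r =>
    simp only [AlgHom.commutes, Matrix.algebraMap_matrix_apply,
      Algebra.TensorProduct.algebraMap_apply]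
    refine ⟨rfl, rfl, ?_⟩
    simp [Algebra.algebraMap_eq_smul_one, TensorProduct.smul_tmul]
  | grade1 j => simp [triangular]
  | mul a b ha hb => simp [Matrix.mul_apply, ha, hb]
  | add a b ha hb => simp [ha, hb, TensorProduct.add_tmul, TensorProduct.tmul_add]

/-- The double derivation `∂ᵢ : F₂ → F₂ ⊗ F₂`; on a word `w` it is the sum of `w' ⊗ w''` over the
factorizations `w = w' (ι i) w''`. -/
noncomputable def partialDeriv (i : Fin 2) : F2 k →ₗ[k] F2 k ⊗[k] F2 k where
  toFun a := triangular k i a 0 1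
  map_add' a b := by simp
  map_smul' r a := by simp

theorem partialDeriv_ι (i j : Fin 2) :
    partialDeriv k i (FreeAlgebra.ι k j) = if j = i then 1 ⊗ₜ[k] 1 else 0 := by
  simp [partialDeriv, triangular]

theorem partialDeriv_mul (i : Fin 2) (a b : F2 k) :
    partialDeriv k i (a * b) =
      partialDeriv k i a * (1 ⊗ₜ[k] b) + (a ⊗ₜ[k] 1) * partialDeriv k i b := by
  obtain ⟨h0, -, -⟩ := triangular_diag k i a
  obtain ⟨-, -, h1⟩ := triangular_diag k i b
  simp [partialDeriv, Matrix.mul_apply, h0, h1, add_comm]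

/-- The double bracket on `F₂ = k⟨x, y⟩` determined by `{{x, y}} = 1 ⊗ 1` and
`{{x, x}} = 0 = {{y, y}}`. -/
noncomputable def bracket : DoubleBracket k (F2 k) :=
  DoubleBracket.ofDoubleDerivations (partialDeriv k 0) (partialDeriv k 1)
    (partialDeriv_mul k 0) (partialDeriv_mul k 1)

theorem bracket_x_y : (bracket k).bracket (x k) (y k) = 1 ⊗ₜ[k] 1 := by
  simp [bracket, DoubleBracket.ofDoubleDerivations_apply, x, y, partialDeriv_ι,
    DoubleBracket.interchange_tmul]

theorem bracket_x_x : (bracket k).bracket (x k) (x k) = 0 := by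
  simp [bracket, DoubleBracket.ofDoubleDerivations_apply, x, partialDeriv_ι]

theorem bracket_y_y : (bracket k).bracket (y k) (y k) = 0 := by
  simp [bracket, DoubleBracket.ofDoubleDerivations_apply, y, partialDeriv_ι]

/-- A double bracket on `F₂` is determined by its values on the generators. -/
theorem bracket_unique (D : DoubleBracket k (F2 k))
    (hxy : D.bracket (x k) (y k) = 1 ⊗ₜ[k] 1) (hxx : D.bracket (x k) (x k) = 0)
    (hyy : D.bracket (y k) (y k) = 0) : D = bracket k := by
  have ext_right : ∀ (D E : DoubleBracket k (F2 k)) (a : F2 k),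
      (∀ j, D.bracket a (FreeAlgebra.ι k j) = E.bracket a (FreeAlgebra.ι k j)) →
      ∀ b, D.bracket a b = E.bracket a b := by
    intro D E a h b
    have one : ∀ D : DoubleBracket k (F2 k), D.bracket a 1 = 0 := by
      intro D
      have := D.right_derivation a 1 1
      rw [← Algebra.TensorProduct.one_def, mul_one, mul_one, one_mul] at this
      exact left_eq_add.mp this
    induction b using FreeAlgebra.induction with
    | grade0 r => simp [Algebra.algebraMap_eq_smul_one, one]
    | grade1 j => exact h j
    | mul b c hb hc => rw [D.right_derivation, E.right_derivation, hb, hc]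
    | add b c hb hc => simp [hb, hc]
  have gen : ∀ i j, D.bracket (FreeAlgebra.ι k i) (FreeAlgebra.ι k j) =
      (bracket k).bracket (FreeAlgebra.ι k i) (FreeAlgebra.ι k j) := by
    intro i j
    fin_cases i <;> fin_cases j
    · exact hxx.trans (bracket_x_x k).symm
    · exact hxy.trans (bracket_x_y k).symm
    · change D.bracket (y k) (x k) = (bracket k).bracket (y k) (x k)
      rw [D.cyclic_antisymm, (bracket k).cyclic_antisymm, hxy, bracket_x_y]
    · exact hyy.trans (bracket_y_y k).symm
  have key : D.bracket = (bracket k).bracket := by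
    ext1 a
    ext1 b
    refine ext_right D _ a (fun j => ?_) b
    rw [D.cyclic_antisymm, (bracket k).cyclic_antisymm]
    rw [ext_right D (bracket k) _ (fun i => gen j i) a]
  generalize bracket k = E at key
  cases D
  cases E
  cases key
  rfl

/-- The moment map `[x, y] = x y - y x`. -/
noncomputable def moment : F2 k := x k * y k - y k * x k

end construction

end F2

/-- The relation `[x, y] - 1 = 0`. -/
inductive Weyl1Rel (k : Type u) [Field k] : F2 k → F2 k → Prop
  | rel : Weyl1Rel k (F2.x k * F2.y k - F2.y k * F2.x k - 1) 0

/-- The first Weyl algebra `A₁ = k⟨x, y⟩ / (x y - y x - 1)`. -/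
abbrev Weyl1 (k : Type u) [Field k] : Type u := RingQuot (Weyl1Rel k)

/-- The projection `F₂ → A₁`. -/
noncomputable def Weyl1.mk (k : Type u) [Field k] : F2 k →ₐ[k] Weyl1 k :=
  RingQuot.mkAlgHom k (Weyl1Rel k)

/-! The triple bracket is cyclically invariant and a derivation in its last argument
(`tripleBracket_mul`), so it vanishes as soon as it vanishes on generators. There it does vanish,
since brackets of generators are multiples of 1 ⊗ 1 and brackets with 1 are zero. Both sides of the
moment map identity are derivations, so it too is checked on generators. A Hamiltonian automorphism
fixes μ, whose image in A₁ is 1, and therefore descends.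

Surjectivity is Dixmier's theorem that the Fourier automorphism and the triangular automorphisms
generate Aut(A₁), together with the fact that both kinds lift to HAut(F₂) (`fourier_mem`,
`triangularAut_mem`). Put P = φ(x). Since ad x is locally nilpotent, so is ad P. Normal ordering
identifies A₁ with k[X₀, X₁] linearly, and for every weight the commutator is the Poisson bracket up
to lower terms. Hence the leading form f of P has locally nilpotent {f, -}
(`locallyNilpotent_poisson`).

The exponential of a locally nilpotent derivation D of a domain gives a degree function: it is
additive on products, lowered by D, and zero on the kernel of D, which for {f, -} contains f. This
restricts f strongly. If both partial degrees a, b of the symbol are positive, its Newton polygon is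
the triangle with vertices (0,0), (a,0), (0,b) (`symbol_mem_weighted_degreeOf`,
`coeff_single_degreeOf_ne_zero`), one of a, b divides the other (`not_X_dvd_pderiv`), and the form
on the hypotenuse has a rational root (`exists_root`). The shear given by that root removes a vertex
and lowers a + b (`exists_reduction`). When a or b is zero, P is a polynomial in one generator, and
a centralizer argument shows that φ is triangular, possibly after a Fourier transform
(`mem_range_of_map_x_mem_adjoin`). -/

namespace DoubleBracket

/-! ### The triple bracket as a derivation in its last argument. -/

section triple

variable {k : Type u} {A : Type v} [Field k] [Ring A] [Algebra k A]

theorem comm_mul (d e : A ⊗[k] A) :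
    TensorProduct.comm k A A (d * e) = TensorProduct.comm k A A d * TensorProduct.comm k A A e :=
  map_mul (Algebra.TensorProduct.comm k A A) d e

theorem left_derivation (D : DoubleBracket k A) (b c a : A) :
    D.bracket (b * c) a = D.bracket b a * (c ⊗ₜ[k] 1) + (1 ⊗ₜ[k] b) * D.bracket c a := by
  rw [D.cyclic_antisymm, D.right_derivation, map_add, comm_mul, comm_mul, D.cyclic_antisymm b a,
    D.cyclic_antisymm c a]
  simp only [TensorProduct.comm_tmul, neg_mul, mul_neg]
  abel

theorem bracket_one_right (D : DoubleBracket k A) (a : A) : D.bracket a 1 = 0 := by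
  have := D.right_derivation a 1 1
  rw [← Algebra.TensorProduct.one_def, mul_one, mul_one, one_mul] at this
  exact left_eq_add.mp this

theorem leftExtend_tmul (D : DoubleBracket k A) (a p q : A) :
    D.leftExtend a (p ⊗ₜ[k] q) = D.bracket a p ⊗ₜ[k] q := rfl

theorem cyclicPerm_mul (d e : (A ⊗[k] A) ⊗[k] A) :
    cyclicPerm k A (d * e) = cyclicPerm k A d * cyclicPerm k A e := by
  have h : ∀ d, cyclicPerm k A d = (Algebra.TensorProduct.assoc k k k A A A).symm
      (Algebra.TensorProduct.comm k (A ⊗[k] A) A d) := fun _ => rfl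
  simp only [h, map_mul]

theorem cyclicPerm_cyclicPerm_cyclicPerm (d : (A ⊗[k] A) ⊗[k] A) :
    cyclicPerm k A (cyclicPerm k A (cyclicPerm k A d)) = d := by
  induction d using TensorProduct.induction_on with
  | zero => simp
  | add d₁ d₂ h₁ h₂ => simp [h₁, h₂]
  | tmul d c =>
    induction d using TensorProduct.induction_on with
    | zero => simp
    | add d₁ d₂ h₁ h₂ => simp [h₁, h₂, TensorProduct.add_tmul]
    | tmul a b => simp [cyclicPerm_tmul]

theorem tripleBracket_cyclic (D : DoubleBracket k A) (a b c : A) :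
    D.tripleBracket a b c = cyclicPerm k A (D.tripleBracket b c a) := by
  simp only [tripleBracket, map_add, cyclicPerm_cyclicPerm_cyclicPerm]
  abel

theorem leftExtend_mul_right (D : DoubleBracket k A) (a d : A) (z : A ⊗[k] A) :
    D.leftExtend a (z * (1 ⊗ₜ[k] d)) = D.leftExtend a z * ((1 ⊗ₜ[k] 1) ⊗ₜ[k] d) := by
  induction z using TensorProduct.induction_on with
  | zero => simp
  | add z₁ z₂ h₁ h₂ => simp [h₁, h₂, add_mul]
  | tmul p q => simp [leftExtend_tmul, ← Algebra.TensorProduct.one_def]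

theorem leftExtend_mul_right' (D : DoubleBracket k A) (a d : A) (z : A ⊗[k] A) :
    D.leftExtend a ((1 ⊗ₜ[k] d) * z) = ((1 ⊗ₜ[k] 1) ⊗ₜ[k] d) * D.leftExtend a z := by
  induction z using TensorProduct.induction_on with
  | zero => simp
  | add z₁ z₂ h₁ h₂ => simp [h₁, h₂, mul_add]
  | tmul p q => simp [leftExtend_tmul, ← Algebra.TensorProduct.one_def]

/-- The bilinear map `(a ⊗ b, c ⊗ d) ↦ a ⊗ b c ⊗ d`. -/
noncomputable def concat (d e : A ⊗[k] A) : (A ⊗[k] A) ⊗[k] A :=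
  (d ⊗ₜ[k] 1) * (Algebra.TensorProduct.assoc k k k A A A).symm (1 ⊗ₜ[k] e)

theorem concat_tmul (a b c d : A) :
    concat (a ⊗ₜ[k] b) (c ⊗ₜ[k] d) = (a ⊗ₜ[k] (b * c)) ⊗ₜ[k] d := by
  simp [concat]

theorem concat_add_left (d d' e : A ⊗[k] A) : concat (d + d') e = concat d e + concat d' e := by
  simp [concat, TensorProduct.add_tmul, add_mul]

theorem concat_add_right (d e e' : A ⊗[k] A) : concat d (e + e') = concat d e + concat d e' := by
  simp [concat, TensorProduct.tmul_add, mul_add]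

theorem concat_zero_left (e : A ⊗[k] A) : concat 0 e = 0 := by simp [concat]

theorem concat_zero_right (d : A ⊗[k] A) : concat d 0 = 0 := by simp [concat]

theorem concat_neg_left (d e : A ⊗[k] A) : concat (-d) e = -concat d e := by
  rw [eq_neg_iff_add_eq_zero, ← concat_add_left, neg_add_cancel, concat_zero_left]

theorem concat_tmul_right (d : A ⊗[k] A) (p q : A) :
    concat d (p ⊗ₜ[k] q) = (d * (1 ⊗ₜ[k] p)) ⊗ₜ[k] q := by
  simp [concat]

/-- The inner bracket also differentiates the factor `c`; `concat` holds this cross term, which has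
to cancel in `tripleBracket_mul`. -/
theorem leftExtend_mul_left (D : DoubleBracket k A) (a c : A) (z : A ⊗[k] A) :
    D.leftExtend a ((c ⊗ₜ[k] 1) * z) =
      concat (D.bracket a c) z + ((c ⊗ₜ[k] 1) ⊗ₜ[k] 1) * D.leftExtend a z := by
  induction z using TensorProduct.induction_on with
  | zero => simp [concat_zero_right]
  | add z₁ z₂ h₁ h₂ => simp only [h₁, h₂, mul_add, map_add, concat_add_right]; abel
  | tmul p q =>
    simp [leftExtend_tmul, concat_tmul_right, D.right_derivation, TensorProduct.add_tmul]

theorem cyclicPerm_leftExtend_mul (D : DoubleBracket k A) (b d : A) (z : A ⊗[k] A) :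
    cyclicPerm k A (D.leftExtend b (z * (d ⊗ₜ[k] 1))) =
      cyclicPerm k A (D.leftExtend b z) * ((1 ⊗ₜ[k] 1) ⊗ₜ[k] d) +
        concat (TensorProduct.comm k A A z) (D.bracket b d) := by
  induction z using TensorProduct.induction_on with
  | zero => simp [concat_zero_left]
  | add z₁ z₂ h₁ h₂ => simp only [h₁, h₂, add_mul, map_add, concat_add_left]; abel
  | tmul p q =>
    have h : ∀ e : A ⊗[k] A, cyclicPerm k A (((p ⊗ₜ[k] 1) * e) ⊗ₜ[k] q) =
        concat (q ⊗ₜ[k] p) e := by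
      intro e
      induction e using TensorProduct.induction_on with
      | zero => simp [concat_zero_right]
      | add e₁ e₂ h₁ h₂ => simp only [h₁, h₂, mul_add, map_add, concat_add_right,
          TensorProduct.add_tmul]
      | tmul r s => simp [concat_tmul, cyclicPerm_tmul]
    have h' : (D.bracket b p * (1 ⊗ₜ[k] d)) ⊗ₜ[k] q =
        (D.bracket b p ⊗ₜ[k] q) * ((1 ⊗ₜ[k] d) ⊗ₜ[k] 1) := by simp
    rw [Algebra.TensorProduct.tmul_mul_tmul, mul_one, leftExtend_tmul, leftExtend_tmul,
      D.right_derivation, TensorProduct.add_tmul, map_add, h, h', cyclicPerm_mul, cyclicPerm_tmul,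
      TensorProduct.comm_tmul]

theorem leftExtend_mul (D : DoubleBracket k A) (c d : A) (z : A ⊗[k] A) :
    D.leftExtend (c * d) z =
      D.leftExtend c z * ((d ⊗ₜ[k] 1) ⊗ₜ[k] 1) + ((1 ⊗ₜ[k] c) ⊗ₜ[k] 1) * D.leftExtend d z := by
  induction z using TensorProduct.induction_on with
  | zero => simp
  | add z₁ z₂ h₁ h₂ => simp only [h₁, h₂, map_add, add_mul, mul_add]; abel
  | tmul p q => simp [leftExtend_tmul, D.left_derivation, TensorProduct.add_tmul]

/-- Besides the expected terms, the Leibniz expansions leave two `concat` terms, one containing {{a,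
c}} and one containing the swap of {{c, a}}. They cancel by cyclic antisymmetry. -/
theorem tripleBracket_mul (D : DoubleBracket k A) (a b c d : A) :
    D.tripleBracket a b (c * d) = D.tripleBracket a b c * ((1 ⊗ₜ[k] 1) ⊗ₜ[k] d) +
      ((c ⊗ₜ[k] 1) ⊗ₜ[k] 1) * D.tripleBracket a b d := by
  simp only [tripleBracket]
  rw [D.right_derivation, D.left_derivation, map_add, map_add, leftExtend_mul_right,
    leftExtend_mul_left, map_add, cyclicPerm_leftExtend_mul, leftExtend_mul_right',
    leftExtend_mul, cyclicPerm_mul, map_add, map_add, D.cyclic_antisymm a c, concat_neg_left]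
  simp only [cyclicPerm_mul, cyclicPerm_tmul]
  simp only [add_mul, mul_add]
  abel

theorem tripleBracket_add (D : DoubleBracket k A) (a b c d : A) :
    D.tripleBracket a b (c + d) = D.tripleBracket a b c + D.tripleBracket a b d := by
  simp only [tripleBracket, leftExtend, map_add, LinearMap.add_apply, LinearMap.rTensor_add]
  abel

theorem tripleBracket_smul (D : DoubleBracket k A) (a b c : A) (r : k) :
    D.tripleBracket a b (r • c) = r • D.tripleBracket a b c := by
  simp only [tripleBracket, leftExtend, map_smul, LinearMap.smul_apply, LinearMap.rTensor_smul,
    smul_add]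

theorem tripleBracket_one (D : DoubleBracket k A) (a b : A) : D.tripleBracket a b 1 = 0 := by
  have := D.tripleBracket_mul a b 1 1
  rw [← Algebra.TensorProduct.one_def, ← Algebra.TensorProduct.one_def, mul_one, mul_one,
    one_mul] at this
  exact left_eq_add.mp this

theorem tripleBracket_rotate_eq_zero {D : DoubleBracket k A} {a b c : A}
    (h : D.tripleBracket a b c = 0) : D.tripleBracket b c a = 0 := by
  rw [tripleBracket_cyclic] at h
  rw [← cyclicPerm_cyclicPerm_cyclicPerm (D.tripleBracket b c a), h, map_zero, map_zero]

end triple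

end DoubleBracket

/-! ### The Hamiltonian structure of F₂ and its elementary automorphisms. -/

namespace F2

section hamiltonian

variable (k : Type u) [Field k]

theorem tripleBracket_eq_zero_of_generators (D : DoubleBracket k (F2 k)) {a b : F2 k}
    (h : ∀ i, D.tripleBracket a b (FreeAlgebra.ι k i) = 0) (c : F2 k) :
    D.tripleBracket a b c = 0 := by
  induction c using FreeAlgebra.induction with
  | grade0 r =>
    rw [Algebra.algebraMap_eq_smul_one, D.tripleBracket_smul, D.tripleBracket_one, smul_zero]
  | grade1 j => exact h j
  | mul b c hb hc => rw [D.tripleBracket_mul, hb, hc, zero_mul, mul_zero, add_zero]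
  | add b c hb hc => rw [D.tripleBracket_add, hb, hc, add_zero]

theorem bracket_y_x : (bracket k).bracket (y k) (x k) = -(1 ⊗ₜ[k] 1) := by
  rw [(bracket k).cyclic_antisymm, bracket_x_y, TensorProduct.comm_tmul]

theorem isPoisson_bracket : (bracket k).IsPoisson := by
  have hgen : ∀ i j, ∃ r : k, (bracket k).bracket (FreeAlgebra.ι k i) (FreeAlgebra.ι k j) =
      r • (1 ⊗ₜ[k] 1) := by
    intro i j
    fin_cases i <;> fin_cases j
    · exact ⟨0, (bracket_x_x k).trans (zero_smul _ _).symm⟩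
    · exact ⟨1, (bracket_x_y k).trans (one_smul _ _).symm⟩
    · exact ⟨-1, (bracket_y_x k).trans (neg_one_smul k _).symm⟩
    · exact ⟨0, (bracket_y_y k).trans (zero_smul _ _).symm⟩
  have h0 : ∀ i j l, (bracket k).leftExtend (FreeAlgebra.ι k i)
      ((bracket k).bracket (FreeAlgebra.ι k j) (FreeAlgebra.ι k l)) = 0 := by
    intro i j l
    obtain ⟨r, hr⟩ := hgen j l
    rw [hr, map_smul, DoubleBracket.leftExtend_tmul, DoubleBracket.bracket_one_right,
      TensorProduct.zero_tmul, smul_zero]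
  have h1 : ∀ i j c, (bracket k).tripleBracket (FreeAlgebra.ι k i) (FreeAlgebra.ι k j) c = 0 :=
    fun i j => tripleBracket_eq_zero_of_generators k _ fun l => by
      simp [DoubleBracket.tripleBracket, h0]
  -- Rotation brings a generator into the last slot, so the reduction to generators frees one
  -- argument at a time.
  have h2 : ∀ j c d, (bracket k).tripleBracket (FreeAlgebra.ι k j) c d = 0 := fun j c =>
    tripleBracket_eq_zero_of_generators k _ fun i =>
      DoubleBracket.tripleBracket_rotate_eq_zero (h1 i j c)
  exact fun a b => tripleBracket_eq_zero_of_generators k _ fun i =>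
    DoubleBracket.tripleBracket_rotate_eq_zero (h2 i a b)

/-- Both sides are derivations in `a` for the outer bimodule structure, so only the generators need
a computation. -/
theorem isMomentMap_moment : (bracket k).IsMomentMap (moment k) := by
  intro a
  induction a using FreeAlgebra.induction with
  | grade0 r =>
    simp [Algebra.algebraMap_eq_smul_one, DoubleBracket.bracket_one_right,
      TensorProduct.smul_tmul]
  | grade1 j =>
    rw [moment, map_sub, LinearMap.sub_apply, DoubleBracket.left_derivation,
      DoubleBracket.left_derivation]
    fin_cases j
    · change (bracket k).bracket (x k) (x k) * _ + _ * (bracket k).bracket (y k) (x k) -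
        ((bracket k).bracket (y k) (x k) * _ + _ * (bracket k).bracket (x k) (x k)) =
        x k ⊗ₜ 1 - 1 ⊗ₜ x k
      rw [bracket_x_x, bracket_y_x]
      simp
      abel
    · change (bracket k).bracket (x k) (y k) * _ + _ * (bracket k).bracket (y k) (y k) -
        ((bracket k).bracket (y k) (y k) * _ + _ * (bracket k).bracket (x k) (y k)) =
        y k ⊗ₜ 1 - 1 ⊗ₜ y k
      rw [bracket_y_y, bracket_x_y]
      simp
  | mul b c hb hc =>
    rw [DoubleBracket.right_derivation, hb, hc]
    simp [sub_mul, mul_sub]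
  | add b c hb hc =>
    rw [map_add, hb, hc, TensorProduct.add_tmul, TensorProduct.tmul_add]
    abel

variable {k}

/-- An automorphism of `F₂` which fixes the moment map and the brackets of the generators is
Hamiltonian. -/
theorem mem_hamiltonianAut {φ : F2 k ≃ₐ[k] F2 k} (hμ : φ (moment k) = moment k)
    (hxy : (bracket k).bracket (φ (x k)) (φ (y k)) = 1 ⊗ₜ[k] 1)
    (hxx : (bracket k).bracket (φ (x k)) (φ (x k)) = 0)
    (hyy : (bracket k).bracket (φ (y k)) (φ (y k)) = 0) :
    φ ∈ (bracket k).hamiltonianAut (moment k) := by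
  let Φ : F2 k ⊗[k] F2 k ≃ₐ[k] F2 k ⊗[k] F2 k := Algebra.TensorProduct.congr φ φ
  have hΦ : ∀ a b, Φ.symm (a ⊗ₜ b) = φ.symm a ⊗ₜ φ.symm b := fun a b => rfl
  have hcomm : ∀ z, Φ.symm (TensorProduct.comm k _ _ z) = TensorProduct.comm k _ _ (Φ.symm z) := by
    intro z
    induction z using TensorProduct.induction_on with
    | zero => simp
    | add z₁ z₂ h₁ h₂ => simp only [map_add, h₁, h₂]
    | tmul p q => simp [hΦ]
  -- The bracket transported along `φ` is a double bracket with the standard values on generators,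
  -- hence equals `bracket k` by uniqueness.
  let D : DoubleBracket k (F2 k) :=
    { bracket := ((bracket k).bracket.compl₁₂ φ.toLinearMap φ.toLinearMap).compr₂
        Φ.symm.toLinearMap
      cyclic_antisymm := fun a b => by
        change Φ.symm ((bracket k).bracket (φ a) (φ b)) =
          -TensorProduct.comm k _ _ (Φ.symm ((bracket k).bracket (φ b) (φ a)))
        rw [(bracket k).cyclic_antisymm, map_neg, hcomm]
      right_derivation := fun a b c => by
        change Φ.symm ((bracket k).bracket (φ a) (φ (b * c))) =
          Φ.symm ((bracket k).bracket (φ a) (φ b)) * _ +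
            _ * Φ.symm ((bracket k).bracket (φ a) (φ c))
        rw [map_mul φ, (bracket k).right_derivation, map_add, map_mul, map_mul, hΦ, hΦ]
        simp }
  have hD : D = bracket k := by
    refine bracket_unique k D ?_ ?_ ?_
    · change Φ.symm ((bracket k).bracket (φ (x k)) (φ (y k))) = _
      rw [hxy, hΦ, map_one]
    · change Φ.symm ((bracket k).bracket (φ (x k)) (φ (x k))) = _
      rw [hxx, map_zero]
    · change Φ.symm ((bracket k).bracket (φ (y k)) (φ (y k))) = _
      rw [hyy, map_zero]
  refine ⟨fun a b => ?_, hμ⟩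
  change (bracket k).bracket (φ a) (φ b) = Φ ((bracket k).bracket a b)
  refine Eq.trans ?_ (congrArg (fun E : DoubleBracket k (F2 k) => Φ (E.bracket a b)) hD)
  change _ = Φ (Φ.symm ((bracket k).bracket (φ a) (φ b)))
  rw [AlgEquiv.apply_symm_apply]

/-- The endomorphism of `F₂` with given values on the generators. -/
noncomputable def hom {B : Type*} [Semiring B] [Algebra k B] (a b : B) : F2 k →ₐ[k] B :=
  FreeAlgebra.lift k ![a, b]

section
variable {B : Type*} [Semiring B] [Algebra k B]

@[simp] theorem hom_x (a b : B) : hom a b (x k) = a := by simp [hom, x]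

@[simp] theorem hom_y (a b : B) : hom a b (y k) = b := by simp [hom, y]

theorem hom_ext {f g : F2 k →ₐ[k] B} (hx : f (x k) = g (x k)) (hy : f (y k) = g (y k)) :
    f = g := by
  refine FreeAlgebra.hom_ext (funext fun i => ?_)
  fin_cases i
  · exact hx
  · exact hy

end

open Polynomial in
theorem aeval_hom {B : Type*} [Semiring B] [Algebra k B] (f : F2 k →ₐ[k] B) (q : k[X]) (a : F2 k) :
    f (aeval a q) = aeval (f a) q :=
  (aeval_algHom_apply f a q).symm

/-- The automorphism `x ↦ y`, `y ↦ -x` of `F₂`. -/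
noncomputable def fourier : F2 k ≃ₐ[k] F2 k :=
  AlgEquiv.ofAlgHom (hom (y k) (-x k)) (hom (-y k) (x k))
    (hom_ext (by simp) (by simp)) (hom_ext (by simp) (by simp))

theorem fourier_x : fourier (x k) = y k := hom_x _ _

theorem fourier_y : fourier (y k) = -x k := hom_y _ _

theorem fourier_mem : (fourier : F2 k ≃ₐ[k] F2 k) ∈ (bracket k).hamiltonianAut (moment k) := by
  refine mem_hamiltonianAut ?_ ?_ ?_ ?_ <;>
    simp only [moment, map_sub, map_mul, fourier_x, fourier_y, map_neg, LinearMap.neg_apply,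
      bracket_x_x, bracket_y_y, bracket_y_x, neg_neg, neg_zero]
  simp
  abel

open Polynomial

theorem partialDeriv_zero_x : partialDeriv k 0 (x k) = 1 ⊗ₜ 1 := by
  simp [x, partialDeriv_ι]

theorem partialDeriv_zero_y : partialDeriv k 0 (y k) = 0 := by
  simp [y, partialDeriv_ι]

theorem partialDeriv_one_x : partialDeriv k 1 (x k) = 0 := by
  simp [x, partialDeriv_ι]

theorem partialDeriv_one_y : partialDeriv k 1 (y k) = 1 ⊗ₜ 1 := by
  simp [y, partialDeriv_ι]

theorem partialDeriv_algebraMap (i : Fin 2) (r : k) :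
    partialDeriv k i (algebraMap k _ r) = 0 := by
  have := partialDeriv_mul k i 1 1
  rw [← Algebra.TensorProduct.one_def, mul_one, mul_one, one_mul] at this
  rw [Algebra.algebraMap_eq_smul_one, map_smul, left_eq_add.mp this, smul_zero]

theorem partialDeriv_one_aeval_x (q : k[X]) : partialDeriv k 1 (aeval (x k) q) = 0 := by
  induction q using Polynomial.induction_on with
  | C r => rw [aeval_C, partialDeriv_algebraMap]
  | add p q hp hq => rw [map_add, map_add, hp, hq, add_zero]
  | monomial n r h =>
    rw [pow_succ, ← mul_assoc, map_mul, partialDeriv_mul, h, aeval_X, partialDeriv_one_x,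
      zero_mul, mul_zero, add_zero]

/-- The derivative is ∑ xⁱ ⊗ xⁿ⁻¹⁻ⁱ, which is symmetric and has all its tensor factors in k[x]. The
commutation clause is what allows the expansions of xⁿ · x and x · xⁿ to be compared. Symmetry later
makes {{y + q(x), y + q(x)}} vanish. -/
theorem partialDeriv_zero_pow_x (n : ℕ) :
    (x k ⊗ₜ[k] 1) * partialDeriv k 0 (x k ^ n) = partialDeriv k 0 (x k ^ n) * (x k ⊗ₜ[k] 1) ∧
    TensorProduct.comm k _ _ (partialDeriv k 0 (x k ^ n)) = partialDeriv k 0 (x k ^ n) := by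
  induction n with
  | zero =>
    rw [pow_zero, ← map_one (algebraMap k (F2 k)), partialDeriv_algebraMap]
    simp
  | succ n ih =>
    have h₁ : partialDeriv k 0 (x k ^ (n + 1)) =
        partialDeriv k 0 (x k ^ n) * (1 ⊗ₜ x k) + (x k ^ n) ⊗ₜ[k] 1 := by
      rw [pow_succ, partialDeriv_mul, partialDeriv_zero_x]
      simp
    have h₂ : partialDeriv k 0 (x k ^ (n + 1)) =
        1 ⊗ₜ (x k ^ n) + (x k ⊗ₜ 1) * partialDeriv k 0 (x k ^ n) := by
      rw [pow_succ', partialDeriv_mul, partialDeriv_zero_x]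
      simp
    constructor
    · rw [h₁, mul_add, add_mul, ← mul_assoc, ih.1, mul_assoc, mul_assoc]
      simp [← pow_succ, ← pow_succ']
    · rw [h₁, map_add, DoubleBracket.comm_mul, ih.2, ← h₁, h₂, ih.1]
      simp [add_comm]

theorem comm_partialDeriv_zero_aeval_x (q : k[X]) :
    TensorProduct.comm k _ _ (partialDeriv k 0 (aeval (x k) q)) =
      partialDeriv k 0 (aeval (x k) q) := by
  induction q using Polynomial.induction_on' with
  | add p q hp hq => rw [map_add, map_add, map_add, hp, hq]
  | monomial n r =>
    rw [aeval_monomial, ← Algebra.smul_def, map_smul, map_smul, (partialDeriv_zero_pow_x n).2]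

theorem interchange_one_left (d : F2 k ⊗[k] F2 k) :
    DoubleBracket.interchange k (F2 k) (1 ⊗ₜ 1) d = d := by
  induction d using TensorProduct.induction_on with
  | zero => simp
  | add z₁ z₂ h₁ h₂ => simp only [map_add, h₁, h₂]
  | tmul p q => simp [DoubleBracket.interchange_tmul]

theorem bracket_aeval_aeval (p q : k[X]) :
    (bracket k).bracket (aeval (x k) p) (aeval (x k) q) = 0 := by
  simp [bracket, DoubleBracket.ofDoubleDerivations_apply, partialDeriv_one_aeval_x]

theorem bracket_y_aeval (q : k[X]) : (bracket k).bracket (y k) (aeval (x k) q) =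
    -partialDeriv k 0 (aeval (x k) q) := by
  simp only [bracket, DoubleBracket.ofDoubleDerivations_apply, partialDeriv_one_aeval_x,
    partialDeriv_zero_y, partialDeriv_one_y, interchange_one_left]
  simp

theorem bracket_aeval_y (q : k[X]) : (bracket k).bracket (aeval (x k) q) (y k) =
    partialDeriv k 0 (aeval (x k) q) := by
  rw [(bracket k).cyclic_antisymm, bracket_y_aeval, map_neg, neg_neg,
    comm_partialDeriv_zero_aeval_x]

/-- The automorphism `x ↦ α x + β`, `y ↦ α⁻¹ y + q(x)` of `F₂`. -/
noncomputable def triangularAut (α : kˣ) (β : k) (q : k[X]) : F2 k ≃ₐ[k] F2 k :=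
  AlgEquiv.ofAlgHom
    (hom ((α : k) • x k + algebraMap k _ β) ((↑α⁻¹ : k) • y k + aeval (x k) q))
    (hom ((↑α⁻¹ : k) • (x k - algebraMap k _ β))
      ((α : k) • (y k - aeval ((↑α⁻¹ : k) • (x k - algebraMap k _ β)) q)))
    (hom_ext (by simp [smul_smul]) (by simp [smul_smul, aeval_hom]))
    (hom_ext (by simp [smul_smul]) (by simp [smul_smul, aeval_hom]))

theorem triangularAut_x (α : kˣ) (β : k) (q : k[X]) :
    triangularAut α β q (x k) = (α : k) • x k + algebraMap k _ β := hom_x _ _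

theorem triangularAut_y (α : kˣ) (β : k) (q : k[X]) :
    triangularAut α β q (y k) = (↑α⁻¹ : k) • y k + aeval (x k) q := hom_y _ _

theorem triangularAut_mem (α : kˣ) (β : k) (q : k[X]) :
    triangularAut α β q ∈ (bracket k).hamiltonianAut (moment k) := by
  have hx : triangularAut α β q (x k) = aeval (x k) (C (α : k) * X + C β) := by
    rw [triangularAut_x]
    simp [Algebra.smul_def]
  have hlin : ∀ b, (bracket k).bracket ((α : k) • x k + algebraMap k _ β) b =
      (α : k) • (bracket k).bracket (x k) b := by
    intro b
    have : (bracket k).bracket (1 : F2 k) b = 0 := by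
      rw [(bracket k).cyclic_antisymm, DoubleBracket.bracket_one_right, map_zero, neg_zero]
    simp [Algebra.algebraMap_eq_smul_one, this]
  refine mem_hamiltonianAut ?_ ?_ ?_ ?_
  · have hc : x k * aeval (x k) q = aeval (x k) q * x k := by
      simpa using congrArg (aeval (x k)) (mul_comm X q)
    rw [moment, map_sub, map_mul, map_mul, triangularAut_x, triangularAut_y]
    simp only [Algebra.algebraMap_eq_smul_one, mul_add, add_mul, hc, one_mul, mul_one,
      smul_mul_assoc, mul_smul_comm, smul_add]
    have h₁ : ∀ z : F2 k, (↑α⁻¹ : k) • (α : k) • z = z := fun z => by simp [smul_smul]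
    have h₂ : ∀ z : F2 k, (α : k) • (↑α⁻¹ : k) • z = z := fun z => by simp [smul_smul]
    rw [h₁, h₂, smul_comm β]
    abel
  · rw [triangularAut_x, triangularAut_y, hlin, map_add, map_smul, bracket_x_y]
    have := bracket_aeval_aeval (k := k) X q
    rw [aeval_X] at this
    rw [this, add_zero, smul_smul]
    simp
  · rw [hx, bracket_aeval_aeval]
  · rw [triangularAut_y]
    simp only [map_add, map_smul, LinearMap.add_apply, LinearMap.smul_apply, bracket_y_y,
      bracket_aeval_aeval, bracket_y_aeval, bracket_aeval_y]
    simp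

end hamiltonian

end F2

/-! ### The normally ordered symbol on A₁. -/

namespace Weyl1

section symbol

variable (k : Type u) [Field k]

open MvPolynomial

/-- The first generator of `A₁`. -/
noncomputable def x : Weyl1 k := mk k (F2.x k)

/-- The second generator of `A₁`. -/
noncomputable def y : Weyl1 k := mk k (F2.y k)

theorem mk_surjective : Function.Surjective (mk k) := RingQuot.mkAlgHom_surjective k _

theorem mk_moment : mk k (F2.moment k) = 1 := by
  have h := RingQuot.mkAlgHom_rel k (Weyl1Rel.rel (k := k))
  rw [map_zero, map_sub, map_one] at h
  exact sub_eq_zero.mp h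

theorem x_mul_y : x k * y k = y k * x k + 1 := by
  have h := mk_moment k
  rw [F2.moment, map_sub, map_mul, map_mul] at h
  exact eq_add_of_sub_eq' h

variable {k}

/-- The algebra homomorphism from `A₁` given by two elements with commutator `1`. -/
noncomputable def hom {B : Type*} [Ring B] [Algebra k B] (a b : B) (h : a * b - b * a = 1) :
    Weyl1 k →ₐ[k] B :=
  RingQuot.liftAlgHom k ⟨F2.hom a b, by rintro _ _ ⟨⟩; simp [h]⟩

section
variable {B : Type*} [Ring B] [Algebra k B]

@[simp] theorem hom_mk (a b : B) (h : a * b - b * a = 1) (c : F2 k) :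
    hom a b h (mk k c) = F2.hom a b c :=
  RingQuot.liftAlgHom_mkAlgHom_apply _ _ _ _

@[simp] theorem hom_x (a b : B) (h : a * b - b * a = 1) : hom a b h (x k) = a := by simp [x]

@[simp] theorem hom_y (a b : B) (h : a * b - b * a = 1) : hom a b h (y k) = b := by simp [y]

theorem hom_ext {f g : Weyl1 k →ₐ[k] B} (hx : f (x k) = g (x k)) (hy : f (y k) = g (y k)) :
    f = g :=
  RingQuot.ringQuot_ext' k _ _ (F2.hom_ext hx hy)

end

theorem induction {C : Weyl1 k → Prop} (algebraMap : ∀ r, C (algebraMap k _ r)) (x : C (x k))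
    (y : C (y k)) (mul : ∀ a b, C a → C b → C (a * b)) (add : ∀ a b, C a → C b → C (a + b))
    (a : Weyl1 k) : C a := by
  obtain ⟨a, rfl⟩ := mk_surjective k a
  induction a using FreeAlgebra.induction with
  | grade0 r => rw [AlgHom.commutes]; exact algebraMap r
  | grade1 i =>
    fin_cases i
    · exact x
    · exact y
  | mul a b ha hb => rw [map_mul]; exact mul _ _ ha hb
  | add a b ha hb => rw [map_add]; exact add _ _ ha hb

variable (k) in
/-- The action of `A₁` on `k[X₀, X₁]` which corresponds to left multiplication on normally ordered
polynomials: `x` acts as `X₀` and `y` as `X₁ - ∂₀`. -/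
noncomputable def act : Weyl1 k →ₐ[k] Module.End k (MvPolynomial (Fin 2) k) :=
  hom (LinearMap.mulLeft k (X 0)) (LinearMap.mulLeft k (X 1) - (pderiv 0).toLinearMap) (by
    refine LinearMap.ext fun g => ?_
    simp only [LinearMap.sub_apply, Module.End.mul_apply, LinearMap.mulLeft_apply,
      Module.End.one_apply, Derivation.coeFn_coe, pderiv_mul,
      pderiv_X_self]
    ring)

theorem act_x (g : MvPolynomial (Fin 2) k) : act k (x k) g = X 0 * g := by
  simp [act]

theorem act_y (g : MvPolynomial (Fin 2) k) : act k (y k) g = X 1 * g - pderiv 0 g := by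
  simp [act]

variable (k) in
/-- The normally ordered symbol of an element of `A₁`; it sends `x ^ i * y ^ j` to
`X₀ ^ i * X₁ ^ j`. -/
noncomputable def symbol : Weyl1 k →ₗ[k] MvPolynomial (Fin 2) k :=
  (LinearMap.applyₗ (1 : MvPolynomial (Fin 2) k)).comp (act k).toLinearMap

theorem symbol_apply (a : Weyl1 k) : symbol k a = act k a 1 := rfl

theorem symbol_mul (a b : Weyl1 k) : symbol k (a * b) = act k a (symbol k b) := by
  simp [symbol_apply]

theorem act_x_pow (n : ℕ) (g : MvPolynomial (Fin 2) k) :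
    act k (x k ^ n) g = X 0 ^ n * g := by
  induction n with
  | zero => simp
  | succ n ih => rw [pow_succ', map_mul, Module.End.mul_apply, ih, act_x]; ring

theorem symbol_y_pow (n : ℕ) : symbol k (y k ^ n) = X 1 ^ n := by
  induction n with
  | zero => simp [symbol_apply]
  | succ n ih =>
    rw [pow_succ', symbol_mul, ih, act_y, pderiv_pow, pderiv_X_of_ne (by decide)]
    ring

theorem symbol_x : symbol k (x k) = X 0 := by simp [symbol_apply, act_x]

theorem symbol_y : symbol k (y k) = X 1 := by simp [symbol_apply, act_y]

theorem symbol_one : symbol k 1 = 1 := by simp [symbol_apply]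

theorem symbol_monomial (i j : ℕ) : symbol k (x k ^ i * y k ^ j) = X 0 ^ i * X 1 ^ j := by
  rw [symbol_mul, symbol_y_pow, act_x_pow]

variable (k) in
/-- The inverse of the symbol map. -/
noncomputable def ofSymbol : MvPolynomial (Fin 2) k →ₗ[k] Weyl1 k :=
  (basisMonomials (Fin 2) k).constr k fun m => x k ^ m 0 * y k ^ m 1

theorem ofSymbol_monomial (m : Fin 2 →₀ ℕ) (r : k) :
    ofSymbol k (monomial m r) = r • (x k ^ m 0 * y k ^ m 1) := by
  have h : monomial m r = r • basisMonomials (Fin 2) k m := by simp [smul_monomial]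
  rw [h, map_smul, ofSymbol, Module.Basis.constr_basis]

theorem monomial_fin_two (m : Fin 2 →₀ ℕ) (r : k) :
    monomial m r = C r * (X 0 ^ m 0 * X 1 ^ m 1) := by
  rw [monomial_eq, Finsupp.prod_fintype _ _ (by simp), Fin.prod_univ_two]

theorem symbol_ofSymbol (g : MvPolynomial (Fin 2) k) : symbol k (ofSymbol k g) = g := by
  induction g using MvPolynomial.induction_on' with
  | monomial m r =>
    rw [ofSymbol_monomial, map_smul, symbol_monomial, monomial_fin_two, smul_eq_C_mul]
  | add p q hp hq => rw [map_add, map_add, hp, hq]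

theorem y_mul_x_pow (n : ℕ) : y k * x k ^ n = x k ^ n * y k - n • x k ^ (n - 1) := by
  induction n with
  | zero => simp
  | succ n ih =>
    have h : y k * x k = x k * y k - 1 := by rw [x_mul_y]; simp
    rw [pow_succ, ← mul_assoc, ih, sub_mul, mul_assoc, h, mul_sub, mul_one, ← mul_assoc, succ_nsmul,
      Nat.add_sub_cancel]
    rcases n with _ | n
    · simp
    · rw [Nat.add_sub_cancel, smul_mul_assoc, ← pow_succ, ← pow_succ]
      abel

/-- It suffices to treat the generators. Only `y` needs reordering, and y xⁿ = xⁿ y - n xⁿ⁻¹ is what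
X₁ - ∂₀ encodes. Evaluating at g = 1 then shows that the symbol is injective. -/
theorem ofSymbol_act (a : Weyl1 k) (g : MvPolynomial (Fin 2) k) :
    ofSymbol k (act k a g) = a * ofSymbol k g := by
  induction a using Weyl1.induction generalizing g with
  | algebraMap r => rw [AlgHom.commutes, Module.algebraMap_end_apply, map_smul, Algebra.smul_def]
  | x =>
    induction g using MvPolynomial.induction_on' with
    | monomial m r =>
      rw [act_x, X, monomial_mul, ofSymbol_monomial, ofSymbol_monomial, mul_smul_comm, ← mul_assoc]
      simp [pow_add]
    | add p q hp hq => rw [map_add, map_add, map_add, hp, hq, mul_add]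
  | y =>
    induction g using MvPolynomial.induction_on' with
    | monomial m r =>
      rw [act_y, X, monomial_mul, pderiv_monomial, map_sub, ofSymbol_monomial, ofSymbol_monomial,
        ofSymbol_monomial, mul_smul_comm, ← mul_assoc, y_mul_x_pow]
      simp [pow_add, sub_mul, smul_sub, mul_assoc, mul_smul, Nat.cast_smul_eq_nsmul,
        (Commute.refl (y k)).pow_right (m 1) |>.eq]
    | add p q hp hq => rw [map_add, map_add, map_add, hp, hq, mul_add]
  | mul a b ha hb => rw [map_mul, Module.End.mul_apply, ha, hb, mul_assoc]
  | add a b ha hb => rw [map_add, LinearMap.add_apply, map_add, ha, hb, add_mul]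

theorem ofSymbol_symbol (a : Weyl1 k) : ofSymbol k (symbol k a) = a := by
  rw [symbol_apply, ofSymbol_act]
  have h := ofSymbol_monomial (k := k) 0 1
  rw [← C_apply, C_1] at h
  rw [h]
  simp

theorem symbol_injective : Function.Injective (symbol k) :=
  Function.LeftInverse.injective ofSymbol_symbol

end symbol

end Weyl1

/-! ### Weighted filtrations and leading forms. -/

namespace Weyl1

section weights

variable {k : Type u} [Field k]

open MvPolynomial

/-- The weighted degree of an exponent. -/
def weight (w : Fin 2 → ℕ) (m : Fin 2 →₀ ℕ) : ℤ := w 0 * m 0 + w 1 * m 1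

theorem weight_add (w : Fin 2 → ℕ) (m n : Fin 2 →₀ ℕ) :
    weight w (m + n) = weight w m + weight w n := by
  simp only [weight, Finsupp.add_apply, Nat.cast_add]
  ring

theorem weight_single (w : Fin 2 → ℕ) (i : Fin 2) (n : ℕ) :
    weight w (Finsupp.single i n) = w i * n := by
  fin_cases i <;> simp [weight]

theorem weight_eq (w : Fin 2 → ℕ) (m : Fin 2 →₀ ℕ) {i j : Fin 2} (h : i ≠ j) :
    weight w m = w i * m i + w j * m j := by
  fin_cases i <;> fin_cases j <;> simp_all [weight, add_comm]

variable (k) in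
/-- Polynomials all of whose monomials have weighted degree in `I`. -/
noncomputable def weighted (w : Fin 2 → ℕ) (I : Set ℤ) : Submodule k (MvPolynomial (Fin 2) k) :=
  restrictSupport k {m | weight w m ∈ I}

variable {w : Fin 2 → ℕ}

theorem mem_weighted {I : Set ℤ} {g : MvPolynomial (Fin 2) k} :
    g ∈ weighted k w I ↔ ∀ m, coeff m g ≠ 0 → weight w m ∈ I := by
  simp only [weighted, mem_restrictSupport_iff, Set.subset_def, Finset.mem_coe, mem_support_iff,
    Set.mem_ofPred_eq]

theorem weighted_mono {I J : Set ℤ} (h : I ⊆ J) : weighted k w I ≤ weighted k w J :=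
  restrictSupport_mono _ fun _ hm => h hm

theorem mul_mem_weighted {I J K : Set ℤ} {g h : MvPolynomial (Fin 2) k}
    (hg : g ∈ weighted k w I) (hh : h ∈ weighted k w J) (hK : ∀ a ∈ I, ∀ b ∈ J, a + b ∈ K) :
    g * h ∈ weighted k w K := by
  have := Submodule.mul_mem_mul hg hh
  rw [weighted, weighted, ← restrictSupport_add] at this
  refine restrictSupport_mono _ ?_ this
  rintro _ ⟨m, hm, n, hn, rfl⟩
  simpa [weight_add] using hK _ hm _ hn

theorem pderiv_mem_weighted {I K : Set ℤ} {g : MvPolynomial (Fin 2) k} (i : Fin 2)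
    (hg : g ∈ weighted k w I) (hK : ∀ a ∈ I, a - w i ∈ K) : pderiv i g ∈ weighted k w K := by
  rw [mem_weighted] at hg ⊢
  intro m hm
  rw [coeff_pderiv] at hm
  have := hK _ (hg _ (left_ne_zero_of_mul hm))
  simpa [weight_add, weight_single] using this

theorem monomial_mem_weighted {I : Set ℤ} {m : Fin 2 →₀ ℕ} (h : weight w m ∈ I) (r : k) :
    monomial m r ∈ weighted k w I := by
  rw [weighted, monomial_mem_restrictSupport]
  exact Or.inl h

theorem X_pow_mem_weighted {I : Set ℤ} {i : Fin 2} {n : ℕ} (h : (w i * n : ℤ) ∈ I) :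
    (X i ^ n : MvPolynomial (Fin 2) k) ∈ weighted k w I := by
  rw [X_pow_eq_monomial]
  exact monomial_mem_weighted (by rwa [weight_single]) _

theorem X_mem_weighted {I : Set ℤ} {i : Fin 2} (h : (w i : ℤ) ∈ I) :
    (X i : MvPolynomial (Fin 2) k) ∈ weighted k w I := by
  simpa using X_pow_mem_weighted (k := k) (w := w) (n := 1) (by simpa using h)

/-- A property of polynomials which is additive holds if it holds for the monomials. -/
theorem weighted_induction {I : Set ℤ} {C : MvPolynomial (Fin 2) k → Prop} (zero : C 0)
    (add : ∀ p q, C p → C q → C (p + q)) (monomial : ∀ m r, weight w m ∈ I → C (monomial m r))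
    {g : MvPolynomial (Fin 2) k} (hg : g ∈ weighted k w I) : C g := by
  rw [mem_weighted] at hg
  rw [g.as_sum]
  exact Finset.sum_induction _ C add zero fun m hm =>
    monomial m _ (hg m (by simpa [mem_support_iff] using hm))

theorem eq_zero_of_mem_weighted {I J : Set ℤ} {g : MvPolynomial (Fin 2) k}
    (hI : g ∈ weighted k w I) (hJ : g ∈ weighted k w J) (h : Disjoint I J) : g = 0 := by
  rw [mem_weighted] at hI hJ
  ext m
  by_contra hm
  exact Set.disjoint_left.mp h (hI m hm) (hJ m hm)

theorem coeff_eq_zero_of_mem_weighted {I : Set ℤ} {g : MvPolynomial (Fin 2) k}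
    (hI : g ∈ weighted k w I) {m : Fin 2 →₀ ℕ} (hm : weight w m ∉ I) : coeff m g = 0 := by
  by_contra h
  exact hm (mem_weighted.mp hI m h)

/-- The component of weighted degree `n`. -/
noncomputable def component (w : Fin 2 → ℕ) (n : ℤ) (g : MvPolynomial (Fin 2) k) :
    MvPolynomial (Fin 2) k :=
  ∑ m ∈ g.support with weight w m = n, monomial m (coeff m g)

theorem coeff_component (n : ℤ) (g : MvPolynomial (Fin 2) k) (m : Fin 2 →₀ ℕ) :
    coeff m (component w n g) = if weight w m = n then coeff m g else 0 := by
  classical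
  simp only [component, coeff_sum, coeff_monomial]
  rw [Finset.sum_ite_eq']
  by_cases h : coeff m g = 0 <;> simp [h]

theorem component_mem (n : ℤ) (g : MvPolynomial (Fin 2) k) :
    component w n g ∈ weighted k w {n} := by
  rw [mem_weighted]
  intro m hm
  rw [coeff_component] at hm
  by_contra h
  exact hm (if_neg h)

theorem sub_component_mem {n : ℤ} {g : MvPolynomial (Fin 2) k}
    (hg : g ∈ weighted k w (Set.Iic n)) :
    g - component w n g ∈ weighted k w (Set.Iic (n - 1)) := by
  rw [mem_weighted] at hg ⊢
  intro m hm
  rw [coeff_sub, coeff_component] at hm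
  split_ifs at hm with h
  · simp at hm
  · have := hg m (by simpa using hm)
    simp only [Set.mem_Iic] at this ⊢
    omega

/-- Up to terms whose weighted degree drops by twice the total weight, the action of an element of
`A₁` is given by its symbol and one correction term. -/
theorem act_sub_mem {a : Weyl1 k} {h : MvPolynomial (Fin 2) k} {M N c : ℤ}
    (ha : symbol k a ∈ weighted k w (Set.Iic N)) (hh : h ∈ weighted k w (Set.Iic M))
    (hc : N + M - 2 * (w 0 + w 1) ≤ c) :
    act k a h - symbol k a * h + pderiv 1 (symbol k a) * pderiv 0 h ∈
      weighted k w (Set.Iic c) := by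
  obtain ⟨g, rfl⟩ : ∃ g, a = ofSymbol k g := ⟨_, (ofSymbol_symbol a).symm⟩
  rw [symbol_ofSymbol] at ha ⊢
  refine weighted_induction (C := fun g => act k (ofSymbol k g) h - g * h +
    pderiv 1 g * pderiv 0 h ∈ weighted k w (Set.Iic c)) (by simp) (fun p q hp hq => ?_)
    (fun m r hm => ?_) ha
  · convert add_mem hp hq using 1
    simp only [map_add, LinearMap.add_apply]
    ring
  · clear ha
    rw [ofSymbol_monomial, monomial_fin_two]
    rw [Set.mem_Iic, weight] at hm
    generalize m 0 = i at hm ⊢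
    generalize m 1 = j at hm ⊢
    clear m
    rw [map_smul, LinearMap.smul_apply, mul_assoc, ← smul_eq_C_mul, ← smul_eq_C_mul,
      Derivation.map_smul, smul_mul_assoc, ← smul_sub, ← smul_add]
    refine Submodule.smul_mem _ _ ?_
    -- Peel off the rightmost y: xⁱ yʲ then acts on X₁ h - ∂₀ h, whose bound rises by `w 1` while
    -- that of the symbol drops by `w 1`. The discrepancy is the second-order term `h₂`.
    induction j generalizing h M N with
    | zero =>
      rw [pow_zero, pow_zero, mul_one, mul_one, act_x_pow, pderiv_pow, pderiv_X_of_ne (by decide)]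
      simp
    | succ j ih =>
      have h₁ : X 1 * h - pderiv 0 h ∈ weighted k w (Set.Iic (M + w 1)) := by
        refine sub_mem (mul_mem_weighted (X_mem_weighted (I := {(w 1 : ℤ)}) rfl) hh ?_)
          (pderiv_mem_weighted _ hh ?_)
        · simp; omega
        · simp; omega
      have h₂ : pderiv 1 (X 0 ^ i * X 1 ^ j : MvPolynomial (Fin 2) k) *
          pderiv 0 (pderiv 0 h) ∈ weighted k w (Set.Iic c) := by
        refine mul_mem_weighted (I := {(w 0 * i + w 1 * j - w 1 : ℤ)})
          (J := Set.Iic (M - w 0 - w 0)) ?_ ?_ ?_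
        · refine pderiv_mem_weighted (I := {(w 0 * i + w 1 * j : ℤ)}) _ (mul_mem_weighted
            (X_pow_mem_weighted (I := {(w 0 * i : ℤ)}) rfl)
            (X_pow_mem_weighted (I := {(w 1 * j : ℤ)}) rfl) ?_) ?_ <;> simp
        · exact pderiv_mem_weighted _ (pderiv_mem_weighted (K := Set.Iic (M - w 0)) _ hh
            (by simp)) (by simp)
        · push_cast at hm
          simp
          intro a ha
          linarith
      have h₃ := ih (N := N - w 1) h₁ (by linarith) (by push_cast at hm; linarith)
      convert add_mem h₃ h₂ using 1
      rw [pow_succ (y k), ← mul_assoc, map_mul, Module.End.mul_apply, act_y, pow_succ (X 1)]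
      simp only [pderiv_mul, pderiv_pow, pderiv_X_self, map_sub]
      rw [pderiv_X_of_ne (by decide), pderiv_X_of_ne (by decide)]
      ring

theorem symbol_mem_weighted_mul {a b : Weyl1 k} {M N c : ℤ}
    (ha : symbol k a ∈ weighted k w (Set.Iic N)) (hb : symbol k b ∈ weighted k w (Set.Iic M))
    (hc : N + M - (w 0 + w 1) ≤ c) :
    symbol k (a * b) - symbol k a * symbol k b ∈ weighted k w (Set.Iic c) := by
  have h₁ := act_sub_mem (c := c) ha hb (by linarith)
  have h₂ : pderiv 1 (symbol k a) * pderiv 0 (symbol k b) ∈ weighted k w (Set.Iic c) := by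
    refine mul_mem_weighted (I := Set.Iic (N - w 1)) (J := Set.Iic (M - w 0))
      (pderiv_mem_weighted _ ha (by simp)) (pderiv_mem_weighted _ hb (by simp)) ?_
    simp only [Set.mem_Iic]
    intros
    linarith
  convert sub_mem h₁ h₂ using 1
  rw [symbol_mul]
  ring

/-- The Poisson bracket `{f, -}` on `k[X₀, X₁]`. -/
noncomputable def poisson (f : MvPolynomial (Fin 2) k) :
    Derivation k (MvPolynomial (Fin 2) k) (MvPolynomial (Fin 2) k) :=
  pderiv 0 f • pderiv 1 - pderiv 1 f • pderiv 0

theorem poisson_apply (f g : MvPolynomial (Fin 2) k) :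
    poisson f g = pderiv 0 f * pderiv 1 g - pderiv 1 f * pderiv 0 g := rfl

theorem poisson_mem {f g : MvPolynomial (Fin 2) k} {I J K : Set ℤ} (hf : f ∈ weighted k w I)
    (hg : g ∈ weighted k w J) (hK : ∀ a ∈ I, ∀ b ∈ J, a + b - (w 0 + w 1) ∈ K) :
    poisson f g ∈ weighted k w K := by
  have h : ∀ (i : Fin 2) (I : Set ℤ) (f : MvPolynomial (Fin 2) k), f ∈ weighted k w I →
      pderiv i f ∈ weighted k w ((· - (w i : ℤ)) '' I) := fun i I f hf =>
    pderiv_mem_weighted i hf fun a ha => ⟨a, ha, rfl⟩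
  refine sub_mem (mul_mem_weighted (h 0 I f hf) (h 1 J g hg) ?_)
    (mul_mem_weighted (h 1 I f hf) (h 0 J g hg) ?_)
  all_goals
    rintro _ ⟨a, ha, rfl⟩ _ ⟨b, hb, rfl⟩
    convert hK a ha b hb using 1
    ring

/-- Every vector is killed by a power of the endomorphism. -/
def LocallyNilpotent {V : Type*} [AddCommGroup V] [Module k V] (T : Module.End k V) : Prop :=
  ∀ a, ∃ n : ℕ, (T ^ n) a = 0

theorem pow_apply_eq_zero_of_le {V : Type*} [AddCommGroup V] [Module k V] {T : Module.End k V}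
    {a : V} {m n : ℕ} (h : (T ^ m) a = 0) (hmn : m ≤ n) : (T ^ n) a = 0 := by
  obtain ⟨d, rfl⟩ := Nat.exists_eq_add_of_le' hmn
  rw [pow_add, Module.End.mul_apply, h, map_zero]

theorem exists_pow_apply_add_eq_zero {V : Type*} [AddCommGroup V] [Module k V]
    {T : Module.End k V} {a b : V} (ha : ∃ n : ℕ, (T ^ n) a = 0) (hb : ∃ n : ℕ, (T ^ n) b = 0) :
    ∃ n : ℕ, (T ^ n) (a + b) = 0 := by
  obtain ⟨m, hm⟩ := ha
  obtain ⟨n, hn⟩ := hb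
  exact ⟨m + n, by rw [map_add, pow_apply_eq_zero_of_le hm (by omega),
    pow_apply_eq_zero_of_le hn (by omega), add_zero]⟩

/-- The inner derivation `a ↦ P a - a P`. -/
noncomputable def ad (P : Weyl1 k) : Module.End k (Weyl1 k) :=
  LinearMap.mulLeft k P - LinearMap.mulRight k P

theorem ad_apply (P a : Weyl1 k) : ad P a = P * a - a * P := rfl

/-- In the commutator the products of symbols cancel, and the two first-order corrections of
`act_sub_mem` form the Poisson bracket. Positive total weight puts the second-order error, and the
replacement of the symbol by `f`, strictly below the main term. -/
theorem symbol_ad_sub_poisson_mem {P a : Weyl1 k} {N M c : ℤ} {f : MvPolynomial (Fin 2) k}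
    (hw : 0 < w 0 + w 1) (hP : symbol k P ∈ weighted k w (Set.Iic N))
    (hf : symbol k P - f ∈ weighted k w (Set.Iic (N - 1)))
    (ha : symbol k a ∈ weighted k w (Set.Iic M)) (hc : N + M - (w 0 + w 1) - 1 ≤ c) :
    symbol k (ad P a) - poisson f (symbol k a) ∈ weighted k w (Set.Iic c) := by
  have hw' : (0 : ℤ) < w 0 + w 1 := by exact_mod_cast hw
  have h₁ := act_sub_mem (c := c) hP ha (by linarith)
  have h₂ := act_sub_mem (c := c) ha hP (by linarith)
  have h₃ : poisson (symbol k P - f) (symbol k a) ∈ weighted k w (Set.Iic c) :=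
    poisson_mem hf ha fun p hp q hq => by
      simp only [Set.mem_Iic] at hp hq ⊢
      linarith
  convert add_mem (sub_mem h₁ h₂) h₃ using 1
  simp only [ad_apply, map_sub, symbol_mul, poisson_apply]
  ring

/-- If `ad P` is locally nilpotent, so is the Poisson bracket with the leading form of `P`. -/
theorem locallyNilpotent_poisson {P : Weyl1 k} (hP : LocallyNilpotent (ad P)) {N : ℤ}
    (hw : 0 < w 0 + w 1) (hN : symbol k P ∈ weighted k w (Set.Iic N)) :
    LocallyNilpotent (poisson (component w N (symbol k P))).toLinearMap := by
  set f := component w N (symbol k P)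
  set T : Module.End k (MvPolynomial (Fin 2) k) := (poisson f).toLinearMap
  have hf : f ∈ weighted k w {N} := component_mem _ _
  set s : ℤ := N - (w 0 + w 1) with hs
  -- For homogeneous `a`, `T ^ n` computes the part of degree exactly M + n s of (ad P)ⁿ a, so it
  -- vanishes once (ad P)ⁿ a does.
  have key : ∀ (a : Weyl1 k) (M : ℤ), symbol k a ∈ weighted k w {M} → ∀ n : ℕ,
      (T ^ n) (symbol k a) ∈ weighted k w {M + n * s} ∧
      symbol k ((ad P ^ n) a) ∈ weighted k w (Set.Iic (M + n * s)) ∧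
      symbol k ((ad P ^ n) a) - (T ^ n) (symbol k a) ∈
        weighted k w (Set.Iic (M + n * s - 1)) := by
    intro a M ha n
    induction n with
    | zero =>
      refine ⟨by simpa using ha, weighted_mono ?_ ha, by simp⟩
      simp
    | succ n ih =>
      obtain ⟨h₁, h₂, h₃⟩ := ih
      have e₁ : (T ^ (n + 1)) (symbol k a) = poisson f ((T ^ n) (symbol k a)) := by
        rw [pow_succ', Module.End.mul_apply]
        rfl
      have h₄ : (T ^ (n + 1)) (symbol k a) ∈ weighted k w {M + (n + 1 : ℕ) * s} := by
        rw [e₁]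
        refine poisson_mem hf h₁ ?_
        simp only [Set.mem_singleton_iff]
        rintro _ rfl _ rfl
        push_cast
        linarith
      have h₅ : symbol k ((ad P ^ (n + 1)) a) - (T ^ (n + 1)) (symbol k a) ∈
          weighted k w (Set.Iic (M + (n + 1 : ℕ) * s - 1)) := by
        have h₆ := symbol_ad_sub_poisson_mem (c := M + (n + 1 : ℕ) * s - 1) hw hN
          (sub_component_mem hN) h₂ (by push_cast; linarith)
        have h₇ : poisson f (symbol k ((ad P ^ n) a) - (T ^ n) (symbol k a)) ∈
            weighted k w (Set.Iic (M + (n + 1 : ℕ) * s - 1)) := by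
          refine poisson_mem hf h₃ ?_
          simp only [Set.mem_singleton_iff, Set.mem_Iic]
          rintro _ rfl b hb
          push_cast
          linarith
        convert add_mem h₆ h₇ using 1
        rw [e₁, map_sub, pow_succ' (ad P), Module.End.mul_apply]
        ring
      refine ⟨h₄, ?_, h₅⟩
      have := add_mem (weighted_mono (J := Set.Iic (M + (n + 1 : ℕ) * s)) (by simp) h₄)
        (weighted_mono (J := Set.Iic (M + (n + 1 : ℕ) * s)) (Set.Iic_subset_Iic.mpr (by simp)) h₅)
      simpa using this
  clear_value T
  intro g
  induction g using MvPolynomial.induction_on' with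
  | monomial m r =>
    obtain ⟨n, hn⟩ := hP (ofSymbol k (monomial m r))
    refine ⟨n, ?_⟩
    obtain ⟨h₁, -, h₃⟩ := key (ofSymbol k (monomial m r)) (weight w m)
      (by rw [symbol_ofSymbol]; exact monomial_mem_weighted (Set.mem_singleton _) r) n
    rw [hn, map_zero, zero_sub] at h₃
    rw [symbol_ofSymbol] at h₁ h₃
    exact eq_zero_of_mem_weighted h₁ (neg_mem_iff.mp h₃) (by simp)
  | add p q hp hq =>
    exact exists_pow_apply_add_eq_zero hp hq

/-- The symbol of the image of `a` under an endomorphism which respects the weights is, up to lower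
terms, obtained by substitution in the symbol of `a`. -/
theorem symbol_map_sub_aeval_mem {τ : Weyl1 k →ₐ[k] Weyl1 k} {N : ℤ} {a : Weyl1 k}
    {t : Fin 2 → MvPolynomial (Fin 2) k} (hw : 0 < w 0 + w 1) (h0 : symbol k (τ (x k)) = t 0)
    (h1 : symbol k (τ (y k)) = t 1) (ht : ∀ i, t i ∈ weighted k w {(w i : ℤ)})
    (ha : symbol k a ∈ weighted k w (Set.Iic N)) :
    symbol k (τ a) - aeval t (symbol k a) ∈ weighted k w (Set.Iic (N - 1)) := by
  obtain ⟨g, rfl⟩ : ∃ g, a = ofSymbol k g := ⟨_, (ofSymbol_symbol a).symm⟩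
  have hw' : (0 : ℤ) < w 0 + w 1 := by exact_mod_cast hw
  have hmul : ∀ (a b : Weyl1 k) (A B : ℤ) (f g : MvPolynomial (Fin 2) k),
      f ∈ weighted k w {A} ∧ symbol k a - f ∈ weighted k w (Set.Iic (A - 1)) →
      g ∈ weighted k w {B} ∧ symbol k b - g ∈ weighted k w (Set.Iic (B - 1)) →
      f * g ∈ weighted k w {A + B} ∧
        symbol k (a * b) - f * g ∈ weighted k w (Set.Iic (A + B - 1)) := by
    rintro a b A B f g ⟨hf, hf'⟩ ⟨hg, hg'⟩
    refine ⟨mul_mem_weighted hf hg (by simp), ?_⟩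
    have hle : ∀ {A : ℤ} {f : MvPolynomial (Fin 2) k} {a : Weyl1 k}, f ∈ weighted k w {A} →
        symbol k a - f ∈ weighted k w (Set.Iic (A - 1)) →
        symbol k a ∈ weighted k w (Set.Iic A) := by
      intro A f a hf hf'
      have := add_mem (weighted_mono (J := Set.Iic A) (Set.Iic_subset_Iic.mpr (by simp)) hf')
        (weighted_mono (J := Set.Iic A) (by simp) hf)
      simpa using this
    have h₁ := symbol_mem_weighted_mul (c := A + B - 1) (hle hf hf') (hle hg hg') (by linarith)
    have h₂ : (symbol k a - f) * symbol k b ∈ weighted k w (Set.Iic (A + B - 1)) :=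
      mul_mem_weighted hf' (hle hg hg') fun p hp q hq => by
        simp only [Set.mem_Iic] at hp hq ⊢
        linarith
    have h₃ : f * (symbol k b - g) ∈ weighted k w (Set.Iic (A + B - 1)) :=
      mul_mem_weighted hf hg' fun p hp q hq => by
        simp only [Set.mem_Iic, Set.mem_singleton_iff] at hp hq ⊢
        linarith
    convert add_mem (add_mem h₁ h₂) h₃ using 1
    ring
  have hpow : ∀ (a : Weyl1 k) (A : ℤ) (f : MvPolynomial (Fin 2) k) (n : ℕ),
      f ∈ weighted k w {A} ∧ symbol k a - f ∈ weighted k w (Set.Iic (A - 1)) →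
      f ^ n ∈ weighted k w {A * n} ∧
        symbol k (a ^ n) - f ^ n ∈ weighted k w (Set.Iic (A * n - 1)) := by
    intro a A f n h
    induction n with
    | zero =>
      refine ⟨?_, by simp [symbol_one]⟩
      simpa using X_pow_mem_weighted (k := k) (w := w) (i := 0) (n := 0) (I := {0}) (by simp)
    | succ n ih =>
      have := hmul _ _ _ _ _ _ ih h
      rw [pow_succ, pow_succ]
      push_cast
      rwa [mul_add, mul_one]
  rw [symbol_ofSymbol] at ha ⊢
  refine weighted_induction (C := fun g => symbol k (τ (ofSymbol k g)) - aeval t g ∈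
    weighted k w (Set.Iic (N - 1))) (by simp) (fun p q hp hq => ?_) (fun m r hm => ?_) ha
  · convert add_mem hp hq using 1
    simp only [map_add]
    ring
  · have h := hmul _ _ _ _ _ _
      (hpow (τ (x k)) (w 0) (t 0) (m 0) ⟨ht 0, by simp [h0]⟩)
      (hpow (τ (y k)) (w 1) (t 1) (m 1) ⟨ht 1, by simp [h1]⟩)
    have h' := Submodule.smul_mem _ r h.2
    rw [ofSymbol_monomial, monomial_fin_two]
    simp only [map_smul, map_mul, map_pow, algHom_C, aeval_X]
    rw [← Algebra.smul_def, ← smul_sub]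
    refine weighted_mono (Set.Iic_subset_Iic.mpr ?_) h'
    rw [Set.mem_Iic, weight] at hm
    linarith

end weights

end Weyl1

/-! ### Locally nilpotent derivations and their degree functions. -/

namespace Weyl1

section locallyNilpotent

variable {k : Type u} [Field k]

open Polynomial in
/-- The exponential `g ↦ ∑ Dⁿ g tⁿ / n!` of a locally nilpotent derivation. -/
theorem exists_exp [CharZero k] {R : Type v} [CommRing R] [Algebra k R] (D : Derivation k R R)
    (hD : LocallyNilpotent D.toLinearMap) :
    ∃ E : R →ₐ[k] R[X], (∀ g, (E g).coeff 0 = g) ∧ ∀ g, E (D g) = derivative (E g) := by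
  set d : ℕ → R →ₗ[k] R := fun n => ((n.factorial : k)⁻¹) • D.toLinearMap ^ n with hd
  have d_zero : ∀ g, d 0 g = g := by simp [hd]
  have d_succ : ∀ n g, ((n + 1 : ℕ) : k) • d (n + 1) g = D (d n g) := by
    intro n g
    have h : ((n : k) + 1) ≠ 0 := by exact_mod_cast n.succ_ne_zero
    simp only [hd, LinearMap.smul_apply, pow_succ', Module.End.mul_apply, Nat.factorial_succ,
      Nat.cast_mul, mul_inv, smul_smul, Derivation.coeFn_coe, Derivation.map_smul]
    push_cast
    rw [mul_inv_cancel_left₀ h]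
  have d_succ' : ∀ n g, ((n + 1 : ℕ) : k) • d (n + 1) g = d n (D g) := by
    intro n g
    have h : ((n : k) + 1) ≠ 0 := by exact_mod_cast n.succ_ne_zero
    simp only [hd, LinearMap.smul_apply, pow_succ, Module.End.mul_apply, Nat.factorial_succ,
      Nat.cast_mul, mul_inv, smul_smul, Derivation.coeFn_coe]
    push_cast
    rw [mul_inv_cancel_left₀ h]
  have d_mul : ∀ n g h, d n (g * h) = ∑ p ∈ Finset.HasAntidiagonal.antidiagonal n, d p.1 g * d p.2 h := by
    intro n g h
    induction n with
    | zero => simp [d_zero]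
    | succ n ih =>
      have hn : ((n + 1 : ℕ) : k) ≠ 0 := by exact_mod_cast n.succ_ne_zero
      refine smul_right_injective R hn ?_
      -- The factor n + 1 splits as p.1 + p.2, matching the two ways in which `D` can fall on a
      -- product.
      have e : ((n + 1 : ℕ) : k) • ∑ p ∈ Finset.HasAntidiagonal.antidiagonal (n + 1), d p.1 g * d p.2 h =
          ∑ p ∈ Finset.HasAntidiagonal.antidiagonal (n + 1), ((p.1 : k) • d p.1 g) * d p.2 h +
          ∑ p ∈ Finset.HasAntidiagonal.antidiagonal (n + 1), d p.1 g * ((p.2 : k) • d p.2 h) := by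
        rw [Finset.smul_sum, ← Finset.sum_add_distrib]
        refine Finset.sum_congr rfl fun p hp => ?_
        rw [smul_mul_assoc, mul_smul_comm, ← add_smul, ← Nat.cast_add,
          Finset.HasAntidiagonal.mem_antidiagonal.mp hp]
      change ((n + 1 : ℕ) : k) • d (n + 1) (g * h) = ((n + 1 : ℕ) : k) • _
      rw [e, d_succ, ih, map_sum, Finset.Nat.sum_antidiagonal_succ,
        Finset.Nat.sum_antidiagonal_succ', ← sub_eq_zero]
      simp only [Nat.cast_zero, zero_smul, zero_mul, mul_zero, zero_add, d_succ,
        Derivation.leibniz, smul_eq_mul, Finset.sum_add_distrib, mul_comm (D _)]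
      ring
  have d_large : ∀ g, ∃ N, ∀ n, N ≤ n → d n g = 0 := by
    intro g
    obtain ⟨N, hN⟩ := hD g
    exact ⟨N, fun n hn => by
      simp only [hd, LinearMap.smul_apply, pow_apply_eq_zero_of_le hN hn, smul_zero]⟩
  choose N hN using d_large
  set F : R → R[X] := fun g => ∑ n ∈ Finset.range (N g), monomial n (d n g) with hF
  have coeff_F : ∀ g n, (F g).coeff n = d n g := by
    intro g n
    simp only [hF, finsetSum_coeff, coeff_monomial, Finset.sum_ite_eq', Finset.mem_range]
    split_ifs with h
    · rfl
    · exact (hN g n (not_lt.mp h)).symm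
  have F_one : F 1 = 1 := by
    ext n
    rw [coeff_F, coeff_one]
    rcases n with _ | n
    · simp [d_zero]
    · have hn : ((n + 1 : ℕ) : k) ≠ 0 := by exact_mod_cast n.succ_ne_zero
      refine smul_right_injective R hn ?_
      change ((n + 1 : ℕ) : k) • d (n + 1) 1 = _
      rw [d_succ']
      simp
  refine ⟨AlgHom.ofLinearMap ⟨⟨F, fun g h => ?_⟩, fun r g => ?_⟩ F_one fun g h => ?_,
    fun g => ?_, fun g => ?_⟩
  · ext n
    simp [coeff_F]
  · ext n
    simp [coeff_F]
  · ext n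
    change (F (g * h)).coeff n = (F g * F h).coeff n
    simp [coeff_F, coeff_mul, d_mul]
  · exact (coeff_F g 0).trans (d_zero g)
  · ext n
    change (F (D g)).coeff n = (derivative (F g)).coeff n
    rw [coeff_derivative, coeff_F, coeff_F, ← d_succ', Algebra.smul_def, mul_comm]
    simp

section exp

variable {R : Type v} [CommRing R] [Algebra k R] {D : Derivation k R R}
  {E : R →ₐ[k] Polynomial R}

/-- `E` turns `D` into d/dt, and a constant `E g` would force `D g = 0`. The t-degree of `E g` is
the degree function used in all the arguments below. -/
theorem natDegree_exp_lt (h0 : ∀ g, (E g).coeff 0 = g)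
    (hE : ∀ g, E (D g) = Polynomial.derivative (E g)) {g : R} (hg : D g ≠ 0) :
    (E (D g)).natDegree < (E g).natDegree := by
  rw [hE]
  refine Polynomial.natDegree_derivative_lt fun h => hg ?_
  rw [← h0 (D g), hE, Polynomial.eq_C_of_natDegree_eq_zero h, Polynomial.derivative_C,
    Polynomial.coeff_zero]

theorem natDegree_exp_mul [IsDomain R] (h0 : ∀ g, (E g).coeff 0 = g) {g h : R} (hg : g ≠ 0)
    (hh : h ≠ 0) : (E (g * h)).natDegree = (E g).natDegree + (E h).natDegree := by
  have h1 : ∀ {g}, g ≠ 0 → E g ≠ 0 := fun {g} hg h => hg (by rw [← h0 g, h, Polynomial.coeff_zero])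
  rw [map_mul, Polynomial.natDegree_mul (h1 hg) (h1 hh)]

theorem natDegree_exp_eq_zero [CharZero k] [IsDomain R]
    (hE : ∀ g, E (D g) = Polynomial.derivative (E g)) {g : R} (hg : D g = 0) :
    (E g).natDegree = 0 := by
  have : CharZero R := charZero_of_injective_algebraMap (algebraMap k R).injective
  rw [← Polynomial.derivative_eq_zero, ← hE, hg, map_zero]

end exp

open MvPolynomial

theorem poisson_self (f : MvPolynomial (Fin 2) k) : poisson f f = 0 := by
  rw [poisson_apply]
  ring

theorem poisson_X_ne_zero {f : MvPolynomial (Fin 2) k} {i j : Fin 2} (hij : i ≠ j)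
    (h : pderiv j f ≠ 0) : poisson f (X i) ≠ 0 := by
  rw [poisson_apply]
  fin_cases i <;> fin_cases j <;> simp_all

theorem natDegree_exp_poisson_X {B : Type*} [Ring B] [Algebra k B]
    (E : MvPolynomial (Fin 2) k →ₐ[k] Polynomial B) (f : MvPolynomial (Fin 2) k) {i j : Fin 2}
    (hij : i ≠ j) : (E (poisson f (X i))).natDegree = (E (pderiv j f)).natDegree := by
  rw [poisson_apply]
  fin_cases i <;> fin_cases j <;> simp_all

/-- A polynomial divisible by one variable whose Poisson bracket is locally nilpotent does not
involve the other variable. -/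
theorem pderiv_eq_zero_of_X_dvd [CharZero k] {f : MvPolynomial (Fin 2) k} {i j : Fin 2} (hij : i ≠ j)
    (hf : LocallyNilpotent (poisson f).toLinearMap) (h0 : f ≠ 0) (h : X i ∣ f) :
    pderiv j f = 0 := by
  obtain ⟨E, hE0, hE⟩ := exists_exp _ hf
  by_contra hne
  have h1 := natDegree_exp_lt hE0 hE (poisson_X_ne_zero hij hne)
  obtain ⟨g, hg⟩ := h
  -- Since {f, f} = 0, `f` has degree 0; by additivity so has its factor `X i`, which contradicts
  -- `h1`.
  have h2 := natDegree_exp_eq_zero hE (poisson_self f)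
  have hg0 : g ≠ 0 := by
    rintro rfl
    exact h0 (by rw [hg, mul_zero])
  rw [hg, natDegree_exp_mul hE0 (X_ne_zero i) hg0] at h2
  omega

/-- Up to sign {f, X i} is the j-th partial of f, so that partial has smaller degree than `X i`;
being a nonzero multiple of `X j`, it has at least the degree of `X j`. Applied both ways round,
this is contradictory, which gives `not_X_dvd_pderiv`. -/
theorem natDegree_exp_X_lt {f : MvPolynomial (Fin 2) k}
    {E : MvPolynomial (Fin 2) k →ₐ[k] Polynomial (MvPolynomial (Fin 2) k)}
    (h0 : ∀ g, (E g).coeff 0 = g) (hE : ∀ g, E (poisson f g) = Polynomial.derivative (E g))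
    {i j : Fin 2} (hij : i ≠ j) (hj : pderiv j f ≠ 0) (hdvd : X j ∣ pderiv j f) :
    (E (X j)).natDegree < (E (X i)).natDegree := by
  have h1 := natDegree_exp_lt h0 hE (poisson_X_ne_zero hij hj)
  rw [natDegree_exp_poisson_X E f hij] at h1
  obtain ⟨g, hg⟩ := hdvd
  have hg0 : g ≠ 0 := by
    rintro rfl
    exact hj (by rw [hg, mul_zero])
  rw [hg, natDegree_exp_mul h0 (X_ne_zero j) hg0] at h1
  omega

theorem not_X_dvd_pderiv [CharZero k] {f : MvPolynomial (Fin 2) k}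
    (hf : LocallyNilpotent (poisson f).toLinearMap) (h0 : pderiv 0 f ≠ 0) (h1 : pderiv 1 f ≠ 0) :
    ¬ X 0 ∣ pderiv 0 f ∨ ¬ X 1 ∣ pderiv 1 f := by
  obtain ⟨E, hE0, hE⟩ := exists_exp _ hf
  by_contra! h
  have h2 := natDegree_exp_X_lt hE0 hE (i := 1) (j := 0) (by decide) h0 h.1
  have h3 := natDegree_exp_X_lt hE0 hE (i := 0) (j := 1) (by decide) h1 h.2
  exact lt_asymm h2 h3

/-- A homogeneous form in `X i` and `X j ^ e` whose Poisson bracket is locally nilpotent has a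
rational root. -/
theorem exists_root [CharZero k] {f : MvPolynomial (Fin 2) k} {i j : Fin 2} (hij : i ≠ j)
    (hf : LocallyNilpotent (poisson f).toLinearMap) {a e : ℕ} (ha : 0 < a)
    (hm : ∀ m ∈ f.support, ∃ q, m i + q = a ∧ m j = e * q)
    (hi : coeff (Finsupp.single i a) f ≠ 0) (hj : pderiv j f ≠ 0) :
    ∃ r : k, eval (Function.update 1 i r) f = 0 := by
  obtain ⟨E, hE0, hE⟩ := exists_exp _ hf
  have hsum : ∀ {B : Type u} [CommRing B] [Algebra k B] (t : Fin 2 → B),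
      aeval t f = ∑ m ∈ f.support, coeff m f • (t i ^ m i * t j ^ m j) := by
    intro B _ _ t
    rw [aeval_def, eval₂_eq']
    refine Finset.sum_congr rfl fun m _ => ?_
    rw [Algebra.smul_def, Fin.prod_univ_two]
    clear * - hij
    fin_cases i <;> fin_cases j <;> simp_all [mul_comm]
  set N := max (E (X i)).natDegree ((E (X j)) ^ e).natDegree with hN
  have hNpos : 0 < N :=
    lt_of_lt_of_le (Nat.zero_lt_of_lt (natDegree_exp_lt hE0 hE (poisson_X_ne_zero hij hj)))
      (le_max_left _ _)
  set U := (E (X i)).coeff N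
  set V := ((E (X j)) ^ e).coeff N
  -- `E f` is constant in t, so its coefficient at a N > 0 vanishes. That coefficient is the form in
  -- `X i` and `X j ^ e` evaluated at (U, V).
  have hUV : ∑ m ∈ f.support, coeff m f • (U ^ m i * V ^ (a - m i)) = 0 := by
    have h1 : E f = aeval (fun l => E (X l)) f := congrArg (· f) (aeval_unique E)
    have h2 : (E f).coeff (a * N) = 0 := by
      refine Polynomial.coeff_eq_zero_of_natDegree_lt ?_
      rw [natDegree_exp_eq_zero hE (poisson_self f)]
      positivity
    rw [h1, hsum, Polynomial.finsetSum_coeff] at h2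
    rw [← h2]
    refine Finset.sum_congr rfl fun m hmf => ?_
    obtain ⟨q, hq, hq'⟩ := hm m hmf
    rw [Polynomial.coeff_smul, hq', pow_mul, ← hq, Nat.add_sub_cancel_left, add_mul,
      Polynomial.coeff_mul_add_eq_of_natDegree_le
        (Polynomial.natDegree_pow_le_of_le _ (le_max_left _ _))
        (Polynomial.natDegree_pow_le_of_le _ (le_max_right _ _)),
      Polynomial.coeff_pow_of_natDegree_le (le_max_left _ _),
      Polynomial.coeff_pow_of_natDegree_le (le_max_right _ _)]
  -- If V = 0, the pure power of `X i` forces U = 0, and then both degrees lie below their maximum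
  -- N.
  have hV : V ≠ 0 := by
    intro hV
    have hU : U = 0 := by
      rw [Finset.sum_eq_single (Finsupp.single i a)] at hUV
      · simpa [hi, ha.ne'] using hUV
      · intro m hmf hne
        obtain ⟨q, hq, hq'⟩ := hm m hmf
        have hq0 : q ≠ 0 := by
          rintro rfl
          refine hne (Finsupp.ext fun l => ?_)
          by_cases hl : l = i
          · subst hl
            simpa using hq
          · have : l = j := by
              clear * - hl hij
              fin_cases l <;> fin_cases i <;> fin_cases j <;> simp_all
            subst this
            rw [Finsupp.single_eq_of_ne hl]
            simpa using hq'
        rw [hV, ← hq, Nat.add_sub_cancel_left, zero_pow hq0, mul_zero, smul_zero]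
      · intro h
        rw [notMem_support_iff.mp h, zero_smul]
    have key : ∀ p : Polynomial (MvPolynomial (Fin 2) k), p.coeff N = 0 → p.natDegree ≤ N →
        p.natDegree < N := fun p hp hle => by
      refine lt_of_le_of_ne hle fun h => ?_
      rw [← h, Polynomial.coeff_natDegree, Polynomial.leadingCoeff_eq_zero] at hp
      rw [hp, Polynomial.natDegree_zero] at h
      omega
    have h1 := key _ hU (le_max_left _ _)
    have h2 := key _ hV (le_max_right _ _)
    exact lt_irrefl N (max_lt h1 h2)
  -- As k is infinite, specializing at a point where V is nonzero makes U / V a root in k itself.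
  obtain ⟨z, hz⟩ : ∃ z, eval z V ≠ 0 := by
    by_contra! h
    exact hV (MvPolynomial.funext fun z => by rw [h z, map_zero])
  refine ⟨eval z U / eval z V, ?_⟩
  have h1 := congrArg (eval z) hUV
  have h2 := hsum (B := k) (Function.update 1 i (eval z U / eval z V))
  rw [← coe_aeval_eq_eval, RingHom.coe_coe, h2]
  simp only [map_sum, smul_eval, map_mul, map_pow, map_zero] at h1
  have h3 : eval z V ^ a * ∑ m ∈ f.support, coeff m f •
      ((Function.update (1 : Fin 2 → k) i (eval z U / eval z V)) i ^ m i *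
        (Function.update (1 : Fin 2 → k) i (eval z U / eval z V)) j ^ m j) = 0 := by
    rw [← h1, Finset.mul_sum]
    refine Finset.sum_congr rfl fun m hmf => ?_
    obtain ⟨q, hq, -⟩ := hm m hmf
    rw [Function.update_self, Function.update_of_ne hij.symm, ← hq, Nat.add_sub_cancel_left,
      pow_add, div_pow, Pi.one_apply, one_pow, smul_eq_mul]
    field_simp
  exact (mul_eq_zero.mp h3).resolve_left (pow_ne_zero _ hz)

end locallyNilpotent

end Weyl1

/-! ### Descent to A₁ and the elementary automorphisms in the image. -/

namespace Weyl1

section descent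

variable {k : Type u} [Field k]

/-- The endomorphism of `A₁` induced by an endomorphism of `F₂` which fixes the moment map. -/
noncomputable def map (φ : F2 k →ₐ[k] F2 k) (h : φ (F2.moment k) = F2.moment k) :
    Weyl1 k →ₐ[k] Weyl1 k :=
  hom (mk k (φ (F2.x k))) (mk k (φ (F2.y k))) (by
    rw [← mk_moment, ← map_mul, ← map_mul, ← map_mul, ← map_mul, ← map_sub, ← map_sub]
    exact congrArg _ h)

theorem map_mk (φ : F2 k →ₐ[k] F2 k) (h : φ (F2.moment k) = F2.moment k) (a : F2 k) :
    map φ h (mk k a) = mk k (φ a) := by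
  rw [map, hom_mk]
  exact DFunLike.congr_fun (F2.hom_ext (g := (mk k).comp φ) (by simp) (by simp)) a

theorem map_moment (φ : (F2.bracket k).hamiltonianAut (F2.moment k)) :
    ((φ : F2 k ≃ₐ[k] F2 k) : F2 k →ₐ[k] F2 k) (F2.moment k) = F2.moment k :=
  φ.2.2

variable (k) in
/-- The homomorphism `HAut(F₂) → Aut(A₁)`. -/
noncomputable def descend :
    (F2.bracket k).hamiltonianAut (F2.moment k) →* (Weyl1 k ≃ₐ[k] Weyl1 k) where
  toFun φ := AlgEquiv.ofAlgHom (map (φ : F2 k ≃ₐ[k] F2 k) (map_moment φ))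
    (map ((φ⁻¹ : (F2.bracket k).hamiltonianAut (F2.moment k)) : F2 k ≃ₐ[k] F2 k)
      (map_moment φ⁻¹))
    (by
      refine AlgHom.ext fun a => ?_
      obtain ⟨a, rfl⟩ := mk_surjective k a
      rw [AlgHom.comp_apply, map_mk, map_mk]
      exact congrArg _ ((φ : F2 k ≃ₐ[k] F2 k).apply_symm_apply a))
    (by
      refine AlgHom.ext fun a => ?_
      obtain ⟨a, rfl⟩ := mk_surjective k a
      rw [AlgHom.comp_apply, map_mk, map_mk]
      exact congrArg _ ((φ : F2 k ≃ₐ[k] F2 k).symm_apply_apply a))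
  map_one' := by
    refine AlgEquiv.ext fun a => ?_
    obtain ⟨a, rfl⟩ := mk_surjective k a
    exact map_mk _ _ a
  map_mul' φ ψ := by
    refine AlgEquiv.ext fun a => ?_
    obtain ⟨a, rfl⟩ := mk_surjective k a
    refine (map_mk _ (map_moment (φ * ψ)) a).trans ?_
    refine (map_mk _ (map_moment φ) _).symm.trans ?_
    exact congrArg _ (map_mk _ (map_moment ψ) a).symm

theorem descend_mk (φ : (F2.bracket k).hamiltonianAut (F2.moment k)) (a : F2 k) :
    descend k φ (mk k a) = mk k ((φ : F2 k ≃ₐ[k] F2 k) a) :=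
  map_mk _ _ a

open Polynomial

theorem exists_fourier :
    ∃ ψ ∈ (descend k).range, ψ (x k) = y k ∧ ψ (y k) = -x k := by
  refine ⟨_, ⟨⟨F2.fourier, F2.fourier_mem⟩, rfl⟩, ?_, ?_⟩
  · rw [x, descend_mk, F2.fourier_x, y]
  · rw [y, descend_mk, F2.fourier_y, map_neg, x]

theorem exists_triangular (α : kˣ) (β : k) (q : k[X]) :
    ∃ ψ ∈ (descend k).range, ψ (x k) = (α : k) • x k + algebraMap k _ β ∧
      ψ (y k) = (↑α⁻¹ : k) • y k + aeval (x k) q := by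
  refine ⟨_, ⟨⟨F2.triangularAut α β q, F2.triangularAut_mem α β q⟩, rfl⟩, ?_, ?_⟩
  · rw [x, descend_mk, F2.triangularAut_x, map_add, map_smul, AlgHom.commutes]
  · rw [y, descend_mk, F2.triangularAut_y, map_add, map_smul, F2.aeval_hom, x]

theorem exists_shear {i j : Fin 2} (hij : i ≠ j) (r : k) (e : ℕ) :
    ∃ ψ ∈ (descend k).range,
      symbol k (ψ (![x k, y k] i)) = MvPolynomial.X i + r • MvPolynomial.X j ^ e ∧
      symbol k (ψ (![x k, y k] j)) = MvPolynomial.X j := by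
  have hx : ∀ n, symbol k (x k ^ n) = MvPolynomial.X 0 ^ n := fun n => by
    simpa using symbol_monomial (k := k) n 0
  fin_cases i <;> fin_cases j
  · exact absurd rfl hij
  · obtain ⟨F, hF, hFx, hFy⟩ := exists_fourier (k := k)
    -- Conjugation by Fourier exchanges the two generators; the sign of r compensates for F⁻¹ x =
    -- -y.
    obtain ⟨T, hT, hTx, hTy⟩ := exists_triangular (1 : kˣ) 0 (monomial e (-r))
    refine ⟨F * T * F⁻¹, mul_mem (mul_mem hF hT) (inv_mem hF), ?_, ?_⟩
    · have h1 : F⁻¹ (x k) = -y k := (F.symm_apply_eq).mpr (by rw [map_neg, hFy, neg_neg])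
      simp [AlgEquiv.mul_apply, h1, hTy, hFy, aeval_monomial, ← Algebra.smul_def, hFx, symbol_x,
        symbol_y_pow, add_comm]
    · have h1 : F⁻¹ (y k) = x k := (F.symm_apply_eq).mpr hFx.symm
      simp [AlgEquiv.mul_apply, h1, hTx, hFx, symbol_y]
  · obtain ⟨T, hT, hTx, hTy⟩ := exists_triangular (1 : kˣ) 0 (monomial e r)
    refine ⟨T, hT, ?_, ?_⟩
    · simp [hTy, aeval_monomial, ← Algebra.smul_def, symbol_y, hx]
    · simp [hTx, symbol_x]
  · exact absurd rfl hij

end descent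

/-! ### The centralizer of x, and automorphisms sending x into k[x] or k[y]. -/

section centralizer

variable {k : Type u} [Field k]

open MvPolynomial

theorem x_mul_y_pow (n : ℕ) : x k * y k ^ n = y k ^ n * x k + n • y k ^ (n - 1) := by
  induction n with
  | zero => simp
  | succ n ih =>
    rw [pow_succ, ← mul_assoc, ih, add_mul, mul_assoc, x_mul_y, mul_add, mul_one, ← mul_assoc,
      succ_nsmul, Nat.add_sub_cancel]
    rcases n with _ | n
    · simp
    · rw [Nat.add_sub_cancel, smul_mul_assoc, ← pow_succ, ← pow_succ]
      abel

theorem symbol_ad_x (a : Weyl1 k) : symbol k (ad (x k) a) = pderiv 1 (symbol k a) := by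
  obtain ⟨g, rfl⟩ : ∃ g, a = ofSymbol k g := ⟨_, (ofSymbol_symbol a).symm⟩
  rw [symbol_ofSymbol]
  induction g using MvPolynomial.induction_on' with
  | monomial m r =>
    have h : ad (x k) (x k ^ m 0 * y k ^ m 1) = m 1 • (x k ^ m 0 * y k ^ (m 1 - 1)) := by
      rw [ad_apply, ← mul_assoc, ← pow_succ', pow_succ, mul_assoc, x_mul_y_pow, mul_add,
        mul_assoc, add_sub_cancel_left, mul_smul_comm]
    rw [ofSymbol_monomial, map_smul, h, map_smul, map_nsmul, symbol_monomial, pderiv_monomial,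
      monomial_fin_two]
    simp [smul_eq_C_mul, mul_assoc, mul_left_comm]
  | add p q hp hq => rw [map_add, map_add, map_add, map_add, hp, hq]

theorem pow_pderiv_monomial (i : Fin 2) (n : ℕ) (m : Fin 2 →₀ ℕ) (r : k) (h : m i < n) :
    ((pderiv i).toLinearMap ^ n : Module.End k (MvPolynomial (Fin 2) k)) (monomial m r) = 0 := by
  induction n generalizing m r with
  | zero => omega
  | succ n ih =>
    rw [pow_succ, Module.End.mul_apply, Derivation.coeFn_coe, pderiv_monomial]
    by_cases hm : m i = 0
    · simp [hm]
    · exact ih _ _ (by simp; omega)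

theorem locallyNilpotent_ad_x : LocallyNilpotent (ad (x k)) := by
  have h1 : ∀ (n : ℕ) (a : Weyl1 k), symbol k ((ad (x k) ^ n) a) =
      ((pderiv 1).toLinearMap ^ n : Module.End k (MvPolynomial (Fin 2) k)) (symbol k a) := by
    intro n
    induction n with
    | zero => simp
    | succ n ih =>
      intro a
      rw [pow_succ, Module.End.mul_apply, ih, symbol_ad_x, pow_succ, Module.End.mul_apply]
      rfl
  have h2 : LocallyNilpotent ((pderiv 1).toLinearMap : Module.End k (MvPolynomial (Fin 2) k)) := by
    intro g
    induction g using MvPolynomial.induction_on' with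
    | monomial m r => exact ⟨_, pow_pderiv_monomial 1 (m 1 + 1) m r (Nat.lt_succ_self _)⟩
    | add p q hp hq => exact exists_pow_apply_add_eq_zero hp hq
  intro a
  obtain ⟨n, hn⟩ := h2 (symbol k a)
  exact ⟨n, symbol_injective (by rw [h1, hn, map_zero])⟩

theorem locallyNilpotent_ad_map (φ : Weyl1 k ≃ₐ[k] Weyl1 k) :
    LocallyNilpotent (ad (φ (x k))) := by
  have h : ∀ (n : ℕ) (a : Weyl1 k), (ad (φ (x k)) ^ n) (φ a) = φ ((ad (x k) ^ n) a) := by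
    intro n
    induction n with
    | zero => simp
    | succ n ih =>
      intro a
      rw [pow_succ, Module.End.mul_apply, pow_succ, Module.End.mul_apply, ← ih]
      simp [ad_apply]
  intro a
  obtain ⟨n, hn⟩ := locallyNilpotent_ad_x (φ.symm a)
  refine ⟨n, ?_⟩
  rw [← φ.apply_symm_apply a, h, hn, map_zero]

theorem mem_adjoin_of_symbol {a : Weyl1 k} {i j : Fin 2} (hij : i ≠ j)
    (h : ∀ m ∈ (symbol k a).support, m j = 0) :
    a ∈ Algebra.adjoin k {![x k, y k] i} := by
  rw [← ofSymbol_symbol a, (symbol k a).as_sum, map_sum]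
  refine sum_mem fun m hm => ?_
  rw [ofSymbol_monomial]
  refine Subalgebra.smul_mem _ ?_ _
  have h0 := h m hm
  fin_cases i <;> fin_cases j <;> simp_all <;>
    exact pow_mem (Algebra.self_mem_adjoin_singleton _ _) _

theorem symbol_aeval_x (p : Polynomial k) :
    symbol k (Polynomial.aeval (x k) p) = Polynomial.aeval (X 0) p := by
  have h : act k (x k) = Algebra.lmul k _ (X 0) := LinearMap.ext fun g => act_x g
  rw [symbol_apply, ← Polynomial.aeval_algHom_apply, h, Polynomial.aeval_algHom_apply]
  simp

theorem aeval_x_injective : Function.Injective (Polynomial.aeval (R := k) (x k)) := by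
  intro p q hpq
  have h1 := congrArg (fun a => MvPolynomial.aeval (fun _ => (Polynomial.X : Polynomial k))
    (symbol k a)) hpq
  simpa [symbol_aeval_x, ← Polynomial.aeval_algHom_apply] using h1

variable [CharZero k]

theorem eq_zero_of_pderiv_eq_zero {g : MvPolynomial (Fin 2) k} {i : Fin 2} (h : pderiv i g = 0)
    {m : Fin 2 →₀ ℕ} (hm : coeff m g ≠ 0) : m i = 0 := by
  by_contra h0
  have h1 := coeff_pderiv (i := i) g (m - Finsupp.single i 1)
  rw [h, coeff_zero, tsub_add_cancel_of_le (by simpa using Nat.one_le_iff_ne_zero.mpr h0)] at h1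
  refine mul_ne_zero hm ?_ h1.symm
  exact Nat.cast_add_one_ne_zero _

theorem exists_aeval_of_commute_x {a : Weyl1 k} (h : x k * a = a * x k) :
    ∃ q : Polynomial k, a = Polynomial.aeval (x k) q := by
  have h1 : pderiv 1 (symbol k a) = 0 := by
    rw [← symbol_ad_x, ad_apply, h, sub_self, map_zero]
  have h2 := mem_adjoin_of_symbol (a := a) (i := 0) (j := 1) (by decide) fun m hm =>
    eq_zero_of_pderiv_eq_zero h1 (mem_support_iff.mp hm)
  rw [Algebra.adjoin_singleton_eq_range_aeval] at h2
  obtain ⟨q, hq⟩ := h2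
  exact ⟨q, hq.symm⟩

/-- Write φ(x) = p(x). Then φ⁻¹(x) commutes with x, because φ maps the two to x and p(x); so φ⁻¹(x)
= q(x), and q ∘ p = X forces p = αX + β. Now φ(y) - α⁻¹ y commutes with x as well, hence is a
polynomial in x, and φ is triangular. -/
theorem mem_range_of_map_x_mem_adjoin (φ : Weyl1 k ≃ₐ[k] Weyl1 k)
    (h : φ (x k) ∈ Algebra.adjoin k {x k}) : φ ∈ (descend k).range := by
  rw [Algebra.adjoin_singleton_eq_range_aeval] at h
  obtain ⟨p, hp⟩ := h
  replace hp : Polynomial.aeval (x k) p = φ (x k) := hp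
  obtain ⟨q, hq⟩ : ∃ q : Polynomial k, φ.symm (x k) = Polynomial.aeval (x k) q := by
    refine exists_aeval_of_commute_x (φ.injective ?_)
    rw [map_mul, map_mul, φ.apply_symm_apply, ← hp]
    simpa using congrArg (Polynomial.aeval (x k)) (mul_comm p Polynomial.X)
  have hdeg : p.natDegree = 1 := by
    have h0 : φ (Polynomial.aeval (x k) q) = Polynomial.aeval (φ (x k)) q :=
      (Polynomial.aeval_algHom_apply (φ : Weyl1 k →ₐ[k] Weyl1 k) (x k) q).symm
    have h1 : Polynomial.aeval (x k) (q.comp p) = Polynomial.aeval (R := k) (x k) Polynomial.X := by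
      rw [Polynomial.aeval_comp, hp, Polynomial.aeval_X, ← h0, ← hq, φ.apply_symm_apply]
    have h2 := congrArg Polynomial.natDegree (aeval_x_injective h1)
    rw [Polynomial.natDegree_comp, Polynomial.natDegree_X] at h2
    exact Nat.eq_one_of_mul_eq_one_left h2
  obtain ⟨α, hα, β, rfl⟩ := Polynomial.natDegree_eq_one.mp hdeg
  replace hp : φ (x k) = α • x k + algebraMap k _ β := by
    rw [← hp]
    simp [Algebra.smul_def]
  have hcomm : x k * φ (y k) = φ (y k) * x k + α⁻¹ • 1 := by
    have h1 := congrArg φ (x_mul_y k)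
    rw [map_mul, map_add, map_mul, map_one, hp, add_mul, mul_add, Algebra.commutes,
      smul_mul_assoc, mul_smul_comm, add_right_comm] at h1
    have h2 := congrArg (α⁻¹ • ·) (add_right_cancel h1)
    simpa [smul_add, smul_smul, hα] using h2
  obtain ⟨r, hr⟩ : ∃ r : Polynomial k, φ (y k) - α⁻¹ • y k = Polynomial.aeval (x k) r := by
    refine exists_aeval_of_commute_x ?_
    rw [mul_sub, sub_mul, hcomm, mul_smul_comm, smul_mul_assoc, x_mul_y, smul_add]
    abel
  obtain ⟨ψ, hψ, hψx, hψy⟩ := exists_triangular (Units.mk0 α hα) β r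
  have : φ = ψ := by
    have h1 : (φ : Weyl1 k →ₐ[k] Weyl1 k) = (ψ : Weyl1 k →ₐ[k] Weyl1 k) := by
      refine hom_ext ?_ ?_
      · exact hp.trans hψx.symm
      · refine Eq.trans ?_ hψy.symm
        rw [← hr]
        simp
    exact AlgEquiv.ext fun a => DFunLike.congr_fun h1 a
  rwa [this]

theorem mem_range_of_map_x_mem_adjoin_y (φ : Weyl1 k ≃ₐ[k] Weyl1 k)
    (h : φ (x k) ∈ Algebra.adjoin k {y k}) : φ ∈ (descend k).range := by
  obtain ⟨F, hF, -, hFy⟩ := exists_fourier (k := k)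
  refine (Subgroup.mul_mem_cancel_left _ hF).mp (mem_range_of_map_x_mem_adjoin (F * φ) ?_)
  rw [Algebra.adjoin_singleton_eq_range_aeval] at h
  obtain ⟨p, hp⟩ := h
  replace hp : Polynomial.aeval (y k) p = φ (x k) := hp
  have h1 : F (Polynomial.aeval (y k) p) = Polynomial.aeval (F (y k)) p :=
    (Polynomial.aeval_algHom_apply (F : Weyl1 k →ₐ[k] Weyl1 k) (y k) p).symm
  rw [AlgEquiv.mul_apply, ← hp, h1, hFy]
  refine Algebra.adjoin_le ?_ (Polynomial.aeval_mem_adjoin_singleton k _)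
  simp [Algebra.self_mem_adjoin_singleton]

end centralizer

end Weyl1

namespace Weyl1

/-! ### Newton polygons and degree reduction. -/

section reduction

variable {k : Type u} [Field k]

open MvPolynomial

theorem finsupp_fin_two_ext {m n : Fin 2 →₀ ℕ} {i j : Fin 2} (hij : i ≠ j) (hi : m i = n i)
    (hj : m j = n j) : m = n := by
  ext l
  fin_cases i <;> fin_cases j <;> fin_cases l <;> simp_all

theorem eq_single_of_apply_eq_zero {m : Fin 2 →₀ ℕ} {i j : Fin 2} (hij : i ≠ j) (h : m j = 0) :
    m = Finsupp.single i (m i) :=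
  finsupp_fin_two_ext hij (by simp) (by rw [h, Finsupp.single_eq_of_ne hij.symm])

theorem X_dvd_of_support {g : MvPolynomial (Fin 2) k} {i : Fin 2}
    (h : ∀ m, coeff m g ≠ 0 → m i ≠ 0) : X i ∣ g := by
  rw [g.as_sum]
  exact Finset.dvd_sum fun m hm => X_dvd_monomial.mpr (Or.inr (h m (mem_support_iff.mp hm)))

theorem exists_coeff_ne_zero_of_degreeOf {g : MvPolynomial (Fin 2) k} {i : Fin 2}
    (h : 0 < degreeOf i g) : ∃ m, coeff m g ≠ 0 ∧ m i = degreeOf i g := by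
  by_contra! hc
  refine lt_irrefl _ ((degreeOf_lt_iff h).mpr fun m hm => ?_)
  exact lt_of_le_of_ne (monomial_le_degreeOf i hm) (hc m (mem_support_iff.mp hm))

theorem le_degreeOf {g : MvPolynomial (Fin 2) k} (i : Fin 2) {m : Fin 2 →₀ ℕ}
    (h : coeff m g ≠ 0) : m i ≤ degreeOf i g :=
  monomial_le_degreeOf i (mem_support_iff.mpr h)

theorem pow_mem_weighted {w : Fin 2 → ℕ} {f : MvPolynomial (Fin 2) k} {A : ℤ} (n : ℕ)
    (h : f ∈ weighted k w {A}) : f ^ n ∈ weighted k w {A * n} := by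
  induction n with
  | zero => simpa using X_pow_mem_weighted (k := k) (w := w) (i := 0) (n := 0) (I := {0}) (by simp)
  | succ n ih =>
    rw [pow_succ]
    exact mul_mem_weighted ih h (by simp; ring)

theorem aeval_mem_weighted {w : Fin 2 → ℕ} {I : Set ℤ} {g : MvPolynomial (Fin 2) k}
    {t : Fin 2 → MvPolynomial (Fin 2) k} (ht : ∀ i, t i ∈ weighted k w {(w i : ℤ)})
    (hg : g ∈ weighted k w I) : aeval t g ∈ weighted k w I := by
  refine weighted_induction (C := fun g => aeval t g ∈ weighted k w I) (by simp)
    (fun p q hp hq => by rw [map_add]; exact add_mem hp hq) (fun m r hm => ?_) hg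
  rw [monomial_fin_two, map_mul, algHom_C, ← Algebra.smul_def, map_mul, map_pow, map_pow, aeval_X,
    aeval_X]
  refine Submodule.smul_mem _ _ (mul_mem_weighted (pow_mem_weighted _ (ht 0))
    (pow_mem_weighted _ (ht 1)) ?_)
  rintro _ rfl _ rfl
  exact hm

variable [CharZero k]

/-- The monomial of highest degree in one of the variables is a pure power. -/
theorem coeff_single_degreeOf_ne_zero {P : Weyl1 k} (hP : LocallyNilpotent (ad P)) {i j : Fin 2}
    (hij : i ≠ j) (hi : 0 < degreeOf i (symbol k P)) :
    coeff (Finsupp.single i (degreeOf i (symbol k P))) (symbol k P) ≠ 0 := by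
  obtain ⟨m, hm, hmi⟩ := exists_coeff_ne_zero_of_degreeOf hi
  set a := degreeOf i (symbol k P)
  -- This weight sees only the degree in `X i`. The leading form is divisible by `X i`, so it cannot
  -- involve `X j`.
  set w : Fin 2 → ℕ := Pi.single i 1 with hw
  have hwt : ∀ m, weight w m = m i := fun m => by
    rw [weight_eq w m hij, hw, Pi.single_eq_same, Pi.single_eq_of_ne hij.symm]
    simp
  have hN : symbol k P ∈ weighted k w (Set.Iic (a : ℤ)) := mem_weighted.mpr fun m hm => by
    rw [hwt]
    exact Int.ofNat_le.mpr (le_degreeOf i hm)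
  have hw0 : 0 < w 0 + w 1 := by
    fin_cases i <;> simp [hw]
  have hf := locallyNilpotent_poisson hP hw0 hN
  set f := component w a (symbol k P)
  have hcoeff : coeff m f = coeff m (symbol k P) := by
    rw [coeff_component, hwt, hmi, if_pos rfl]
  have hdvd : X i ∣ f := X_dvd_of_support fun m hm => by
    rw [coeff_component, hwt] at hm
    have h : (m i : ℤ) = a := by
      by_contra h
      exact hm (if_neg h)
    omega
  have h0 : f ≠ 0 := fun h => hm (by rw [← hcoeff, h, coeff_zero])
  have hj := eq_zero_of_pderiv_eq_zero (pderiv_eq_zero_of_X_dvd hij hf h0 hdvd)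
    (hcoeff.symm ▸ hm)
  rw [eq_single_of_apply_eq_zero hij hj, hmi] at hm
  exact hm

/-- The Newton polygon of an element with locally nilpotent adjoint action is a triangle. -/
theorem symbol_mem_weighted_degreeOf {P : Weyl1 k} (hP : LocallyNilpotent (ad P))
    (h0 : 0 < degreeOf 0 (symbol k P)) :
    symbol k P ∈ weighted k ![degreeOf 1 (symbol k P), degreeOf 0 (symbol k P)]
      (Set.Iic (degreeOf 0 (symbol k P) * degreeOf 1 (symbol k P) : ℤ)) := by
  set p := symbol k P with hp
  set a := degreeOf 0 p with ha
  set b := degreeOf 1 p with hb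
  -- The weight for which (a, 0) and (0, b) both have degree ab.
  set w : Fin 2 → ℕ := ![b, a]
  have hwt : ∀ m, weight w m = b * m 0 + a * m 1 := fun m => rfl
  have hp0 : p.support.Nonempty := by
    rw [support_nonempty]
    exact ne_zero_of_degreeOf_ne_zero (i := 0) h0.ne'
  obtain ⟨m, hm, hmax⟩ := Finset.exists_max_image p.support (weight w) hp0
  refine mem_weighted.mpr fun m' hm' => (hmax m' (mem_support_iff.mpr hm')).trans ?_
  -- Points with X₀-exponent 0 have weight at most ab, so a heavier leading form would be divisible
  -- by X₀. It would then be free of X₁, and so of weight at most ab after all.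
  by_contra! hlt
  set n := weight w m with hn
  have hN : symbol k P ∈ weighted k w (Set.Iic n) := mem_weighted.mpr fun m' hm' =>
    hmax m' (mem_support_iff.mpr hm')
  have hf := locallyNilpotent_poisson hP (by simp [w]; omega) hN
  set f := component w n (symbol k P)
  have hcoeff : coeff m f ≠ 0 := by
    rw [coeff_component, if_pos hn.symm]
    exact mem_support_iff.mp hm
  have hf0 : f ≠ 0 := fun h => hcoeff (by rw [h, coeff_zero])
  have hdvd : X 0 ∣ f := X_dvd_of_support fun m' hm' hzero => by
    rw [coeff_component] at hm'
    split_ifs at hm' with h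
    · rw [hwt, hzero] at h
      have h1 : (m' 1 : ℤ) ≤ b := Int.ofNat_le.mpr (le_degreeOf 1 hm')
      have h2 : (a : ℤ) * m' 1 ≤ a * b := mul_le_mul_of_nonneg_left h1 (Int.natCast_nonneg _)
      simp at h
      omega
    · exact hm' rfl
  have h1 := eq_zero_of_pderiv_eq_zero
    (pderiv_eq_zero_of_X_dvd (i := 0) (j := 1) (by decide) hf hf0 hdvd) hcoeff
  have h2 : (m 0 : ℤ) ≤ a := Int.ofNat_le.mpr (monomial_le_degreeOf 0 hm)
  have h3 : (b : ℤ) * m 0 ≤ b * a := mul_le_mul_of_nonneg_left h2 (Int.natCast_nonneg _)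
  rw [hwt, h1] at hn
  rw [mul_comm (b : ℤ) a] at h3
  simp at hn
  omega

/-- If both partial degrees of an element with locally nilpotent adjoint action are positive, then
a shear lowers one of them without raising the other. -/
theorem exists_reduction {P : Weyl1 k} (hP : LocallyNilpotent (ad P))
    (hLN : ∀ ψ : Weyl1 k ≃ₐ[k] Weyl1 k, LocallyNilpotent (ad (ψ P)))
    (h0 : 0 < degreeOf 0 (symbol k P)) (h1 : 0 < degreeOf 1 (symbol k P)) :
    ∃ ψ ∈ (descend k).range,
      degreeOf 0 (symbol k (ψ P)) + degreeOf 1 (symbol k (ψ P)) <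
        degreeOf 0 (symbol k P) + degreeOf 1 (symbol k P) := by
  have hN := symbol_mem_weighted_degreeOf hP h0
  set p := symbol k P with hp
  set d : Fin 2 → ℕ := fun i => degreeOf i p with hd
  have hdpos : ∀ i, 0 < d i := fun i => by
    fin_cases i
    · exact h0
    · exact h1
  set w : Fin 2 → ℕ := ![degreeOf 1 p, degreeOf 0 p] with hw
  set N : ℤ := degreeOf 0 p * degreeOf 1 p with hNdef
  have hwd : ∀ {i j : Fin 2}, i ≠ j → w i = d j ∧ N = d i * d j := fun {i j} hij => by
    fin_cases i <;> fin_cases j <;> simp_all [mul_comm]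
  have hwt : ∀ {i j : Fin 2}, i ≠ j → ∀ m, weight w m = d j * m i + d i * m j :=
    fun {i j} hij m => by
      rw [weight_eq w m hij, (hwd hij).1, (hwd hij.symm).1]
  have hw0 : 0 < w 0 + w 1 := Nat.add_pos_left h1 _
  have hf := locallyNilpotent_poisson hP hw0 hN
  have hfN : component w N p ∈ weighted k w {N} := component_mem _ _
  have hpf : p - component w N p ∈ weighted k w (Set.Iic (N - 1)) := sub_component_mem hN
  set f := component w N p
  have hcoeff : ∀ {i j : Fin 2}, i ≠ j → coeff (Finsupp.single i (d i)) f ≠ 0 :=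
    fun {i j} hij => by
      rw [coeff_component, if_pos]
      · exact coeff_single_degreeOf_ne_zero hP hij (hdpos i)
      · rw [hwt hij, (hwd hij).2, Finsupp.single_eq_same, Finsupp.single_eq_of_ne hij.symm]
        ring
  have hpderiv : ∀ {i j : Fin 2}, i ≠ j → pderiv i f ≠ 0 := fun {i j} hij h => by
    have := eq_zero_of_pderiv_eq_zero h (hcoeff hij)
    rw [Finsupp.single_eq_same] at this
    exact (hdpos i).ne' this
  have hmem : ∀ m, coeff m f ≠ 0 → weight w m = N ∧ ∀ i, m i ≤ d i := fun m hm => by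
    refine ⟨mem_weighted.mp hfN m hm, fun i => le_degreeOf i fun h => hm ?_⟩
    rw [coeff_component, h, ite_self]
  -- If `X i` does not divide the i-th partial of f, then f has a monomial with `X i`-exponent 1. On
  -- the edge this reads d j + d i * m j = d i * d j, so d i divides d j.
  obtain ⟨i, j, hij, e, he⟩ : ∃ i j : Fin 2, i ≠ j ∧ d i ∣ d j := by
    have key : ∀ {i j : Fin 2}, i ≠ j → ¬ X i ∣ pderiv i f → d i ∣ d j := fun {i j} hij h => by
      by_contra hdvd
      refine h (X_dvd_of_support fun m hm hmi => hdvd ?_)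
      rw [coeff_pderiv] at hm
      have := (hmem _ (left_ne_zero_of_mul hm)).1
      rw [hwt hij, (hwd hij).2, Finsupp.add_apply, Finsupp.add_apply, hmi,
        Finsupp.single_eq_same, Finsupp.single_eq_of_ne hij.symm] at this
      have h2 : d j + d i * m j = d i * d j := by
        zify
        simpa using this
      exact (Nat.dvd_add_left (dvd_mul_right _ _)).mp (h2 ▸ dvd_mul_right _ _)
    rcases not_X_dvd_pderiv hf (hpderiv (j := 1) (by decide)) (hpderiv (j := 0) (by decide)) with
      h | h
    · exact ⟨0, 1, by decide, key (by decide) h⟩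
    · exact ⟨1, 0, by decide, key (by decide) h⟩
  obtain ⟨r, hr⟩ := exists_root hij hf (hdpos i) (e := e) (fun m hm => by
    obtain ⟨hm1, hm2⟩ := hmem m (mem_support_iff.mp hm)
    obtain ⟨q, hq⟩ := Nat.exists_eq_add_of_le (hm2 i)
    refine ⟨q, hq.symm, ?_⟩
    rw [hwt hij, (hwd hij).2, he] at hm1
    have h2 : d i * (e * m i + m j) = d i * (e * (m i + q)) := by
      rw [← hq]
      zify
      push_cast at hm1
      linarith
    have h3 := Nat.eq_of_mul_eq_mul_left (hdpos i) h2
    rw [mul_add] at h3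
    exact Nat.add_left_cancel h3) (hcoeff hij) (hpderiv hij.symm)
  obtain ⟨ψ, hψ, hψi, hψj⟩ := exists_shear hij r e
  refine ⟨ψ, hψ, ?_⟩
  set t : Fin 2 → MvPolynomial (Fin 2) k := fun l => symbol k (ψ (![x k, y k] l)) with htdef
  have hti : t i = X i + r • X j ^ e := hψi
  have htj : t j = X j := hψj
  -- The substitution is weighted homogeneous because w i = d j = e * d i = e * w j.
  have ht : ∀ l, t l ∈ weighted k w {(w l : ℤ)} := fun l => by
    by_cases hl : l = i
    · rw [hl, hti]
      refine add_mem (X_mem_weighted rfl) (Submodule.smul_mem _ _ (X_pow_mem_weighted ?_))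
      rw [(hwd hij).1, (hwd hij.symm).1, he]
      simp
    · have : l = j := by
        clear * - hl hij
        fin_cases l <;> fin_cases i <;> fin_cases j <;> simp_all
      rw [this, htj]
      exact X_mem_weighted rfl
  have hsub : symbol k (ψ P) - aeval t p ∈ weighted k w (Set.Iic (N - 1)) :=
    symbol_map_sub_aeval_mem (τ := (ψ : Weyl1 k →ₐ[k] Weyl1 k)) hw0 rfl rfl ht hN
  have hmem' : symbol k (ψ P) ∈ weighted k w (Set.Iic N) := by
    have := add_mem (weighted_mono (J := Set.Iic N) (Set.Iic_subset_Iic.mpr (by simp)) hsub)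
      (aeval_mem_weighted ht hN)
    simpa using this
  have hlead : symbol k (ψ P) - aeval t f ∈ weighted k w (Set.Iic (N - 1)) := by
    have := add_mem hsub (aeval_mem_weighted ht hpf)
    simpa using this
  -- On the edge, this coefficient is the value at X i = 0, X j = 1; the shear moves that point to X
  -- i = r, where f vanishes.
  have hzero : coeff (Finsupp.single j (d j)) (aeval t f) = 0 := by
    have h2 : eval (Function.update 1 i 0) (aeval t f) = 0 := by
      refine Eq.trans ?_ hr
      rw [← coe_aeval_eq_eval, RingHom.coe_coe, ← AlgHom.comp_apply, ← coe_aeval_eq_eval,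
        RingHom.coe_coe]
      congr 1
      refine algHom_ext fun l => ?_
      rw [AlgHom.comp_apply, aeval_X, aeval_X]
      by_cases hl : l = i
      · rw [hl, hti]
        simp [Function.update_of_ne hij.symm]
      · have : l = j := by
          clear * - hl hij
          fin_cases l <;> fin_cases i <;> fin_cases j <;> simp_all
        rw [this, htj]
        simp [Function.update_of_ne hij.symm]
    have hg := aeval_mem_weighted ht hfN
    rw [eval_eq', Finset.sum_eq_single (Finsupp.single j (d j))] at h2
    · rw [Finset.prod_eq_one, mul_one] at h2
      · exact h2
      · intro l _
        by_cases hl : l = i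
        · rw [hl, Finsupp.single_eq_of_ne hij, pow_zero]
        · rw [Function.update_of_ne hl, Pi.one_apply, one_pow]
    · intro m hm hne
      have hmi : m i ≠ 0 := fun hmi => by
        refine hne ?_
        rw [eq_single_of_apply_eq_zero hij.symm hmi]
        congr 1
        have := mem_weighted.mp hg m (mem_support_iff.mp hm)
        rw [Set.mem_singleton_iff, hwt hij, (hwd hij).2, hmi] at this
        have h3 : d i * m j = d i * d j := by
          zify
          simpa using this
        exact Nat.eq_of_mul_eq_mul_left (hdpos i) h3
      rw [Finset.prod_eq_zero (Finset.mem_univ i), mul_zero]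
      rw [Function.update_self, zero_pow hmi]
    · intro h
      rw [notMem_support_iff.mp h, zero_mul]
  have hzero' : coeff (Finsupp.single j (d j)) (symbol k (ψ P)) = 0 := by
    have := coeff_eq_zero_of_mem_weighted hlead (m := Finsupp.single j (d j)) (by
      rw [hwt hij, Finsupp.single_eq_same, Finsupp.single_eq_of_ne hij, (hwd hij).2]
      simp)
    rw [coeff_sub, hzero, sub_zero] at this
    exact this
  have hle : ∀ {i j : Fin 2}, i ≠ j → degreeOf i (symbol k (ψ P)) ≤ d i := fun {i j} hij => by
    refine degreeOf_le_iff.mpr fun m hm => ?_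
    have := mem_weighted.mp hmem' m (mem_support_iff.mp hm)
    rw [Set.mem_Iic, hwt hij, (hwd hij).2] at this
    have h3 : d j * m i ≤ d j * d i := by
      have h4 : d j * m i + d i * m j ≤ d i * d j := by exact_mod_cast this
      rw [mul_comm (d j) (d i)]
      omega
    exact Nat.le_of_mul_le_mul_left h3 (hdpos j)
  -- An unchanged degree would put a nonzero pure power of `X j` at the vertex that has just been
  -- removed.
  have hlt : degreeOf j (symbol k (ψ P)) < d j := by
    refine lt_of_le_of_ne (hle hij.symm) fun h => ?_
    have := coeff_single_degreeOf_ne_zero (hLN ψ) hij.symm (by rw [h]; exact hdpos j)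
    rw [h] at this
    exact this hzero'
  have hle' := hle hij
  change _ < d 0 + d 1
  clear * - hij hlt hle'
  fin_cases i <;> fin_cases j <;> simp_all <;> omega

/-- Strong induction on the sum of the partial degrees of the symbol of φ(x): composing with a shear
from the image lowers the sum until one of the degrees is zero. -/
theorem descend_surjective : Function.Surjective (descend k) := by
  rw [← MonoidHom.range_eq_top, eq_top_iff]
  have key : ∀ (n : ℕ) (φ : Weyl1 k ≃ₐ[k] Weyl1 k),
      degreeOf 0 (symbol k (φ (x k))) + degreeOf 1 (symbol k (φ (x k))) = n →
      φ ∈ (descend k).range := by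
    intro n
    induction n using Nat.strong_induction_on with
    | _ n ih =>
      intro φ hn
      have hzero : ∀ i, degreeOf i (symbol k (φ (x k))) = 0 →
          ∀ m ∈ (symbol k (φ (x k))).support, m i = 0 := fun i h m hm =>
        Nat.le_zero.mp (h ▸ monomial_le_degreeOf i hm)
      rcases Nat.eq_zero_or_pos (degreeOf 0 (symbol k (φ (x k)))) with h0 | h0
      · exact mem_range_of_map_x_mem_adjoin_y φ
          (mem_adjoin_of_symbol (i := 1) (j := 0) (by decide) (hzero 0 h0))
      rcases Nat.eq_zero_or_pos (degreeOf 1 (symbol k (φ (x k)))) with h1 | h1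
      · exact mem_range_of_map_x_mem_adjoin φ
          (mem_adjoin_of_symbol (i := 0) (j := 1) (by decide) (hzero 1 h1))
      obtain ⟨ψ, hψ, hlt⟩ := exists_reduction (locallyNilpotent_ad_map φ)
        (fun ψ => locallyNilpotent_ad_map (ψ * φ)) h0 h1
      exact (Subgroup.mul_mem_cancel_left _ hψ).mp (ih _ (hn ▸ hlt) (ψ * φ) rfl)
  exact fun φ _ => key _ φ rfl

end reduction

end Weyl1

theorem mainTheorem8 (k : Type u) [Field k] [CharZero k] :
    -- `(F₂, {{-,-}}, [x, y])` is a Hamiltonian algebra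
    (F2.bracket k).IsPoisson ∧ (F2.bracket k).IsMomentMap (F2.moment k) ∧
    -- every Hamiltonian automorphism descends to `A₁`, and the resulting group homomorphism
    -- `HAut(F₂) → Aut(A₁)` is surjective
    ∃ π : (F2.bracket k).hamiltonianAut (F2.moment k) →* (Weyl1 k ≃ₐ[k] Weyl1 k),
      (∀ (φ : (F2.bracket k).hamiltonianAut (F2.moment k)) (a : F2 k),
        π φ (Weyl1.mk k a) = Weyl1.mk k ((φ : F2 k ≃ₐ[k] F2 k) a)) ∧
      Function.Surjective π :=
  ⟨F2.isPoisson_bracket k, F2.isMomentMap_moment k, Weyl1.descend k, Weyl1.descend_mk,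
    Weyl1.descend_surjective⟩
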